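/- Let $V$ be a countably infinite set and let $b:V\times V\to[0,\infty)$ satisfy $b(x,x)=0$, $b(x,y)=b(y,x)$ and $\sum_{y\in V}b(x,y)<\infty$ for all $x,y\in V$. Assume that the graph $(b,0)$ is connected, i.e. for all $x,y\in V$ there are $x=x_0,\dots,x_n=y$ in $V$ with $b(x_{j},x_{j+1})>0$ for $0\le j<n$. Let $m:V\to(0,\infty)$. For $u:V\to\mathbb R$ put $$\widetilde Q(u)=\tfrac12\sum_{x,y\in V}b(x,y)(u(x)-u(y))^2\in[0,\infty],\qquad \widetilde D=\{u:V\to\mathbb R:\ \widetilde Q(u)<\infty\},$$ and for $u,v\in\widetilde D$ put $$\widetilde Q(u,v)=\tfrac12\sum_{x,y\in V}b(x,y)(u(x)-u(y))(v(x)-v(y)),\qquad (\widetilde Lu)(x)=\frac1{m(x)}\sum_{y\in V}b(x,y)(u(x)-u(y)),$$ where all sums converge absolutely. Let $\ell^p(V,m)$ be the space of all $f:V\to\mathbb R$ with $\sum_{x}|f(x)|^pm(x)<\infty$, and let $\langle f,g\rangle=\sum_x f(x)g(x)m(x)$ be the inner product of $\ell^2(V,m)$. Let $Q^D$ be the restriction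 of $\widetilde Q$ to $D(Q^D)$, the closure of the finitely supported functions in $\widetilde D\cap\ell^2(V,m)$ with respect to the norm $(\widetilde Q(u)+\|u\|_2^2)^{1/2}$. Let $L$ be the associated non-negative self-adjoint operator on $\ell^2(V,m)$, i.e. $u\in D(L)$ and $Lu=w$ if and only if $u\in D(Q^D)$, $w\in\ell^2(V,m)$ and $\widetilde Q(u,v)=\langle w,v\rangle$ for all $v\in D(Q^D)$, and let $(e^{-tL})_{t>0}$ be the semigroup generated by $-L$. The form $Q^D$ is called recurrent if $$\int_0^\infty (e^{-tL}\delta_x)(y)\,dt=\infty\quad\text{for all }x,y\in V,$$ where $\delta_x$ is the function with value $1$ at $x$ and $0$ elsewhere. Then $Q^D$ is recurrent if and only if $$\sum_{x\in V}(\widetilde Lu)(x)\,m(x)=0\quad\text{for every }u\in\widetilde D\text{ with }\widetilde Lu\in\ell^1(V,m).$$ -/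

import Mathlib

open MeasureTheory Filter Topology Set
open scoped ENNReal

/-- A weighted graph `(b, 0)` over the vertex set `V` (edge weights `b`, no killing term). -/
structure WeightedGraph (V : Type*) where
  b : V → V → ℝ
  nonneg : ∀ x y, 0 ≤ b x y
  loopless : ∀ x, b x x = 0
  symm : ∀ x y, b x y = b y x
  summable : ∀ x, Summable (b x)

/-- The measure of density `m` on the discrete space `V`: every vertex `x` has mass `m x`. -/
noncomputable def massMeasure {V : Type*} [MeasurableSpace V] (m : V → ℝ) : Measure V :=
  Measure.sum fun x => ENNReal.ofReal (m x) • Measure.dirac x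

theorem massMeasure_singleton {V : Type*} [MeasurableSpace V] [DiscreteMeasurableSpace V]
    (m : V → ℝ) (x : V) : massMeasure m {x} = ENNReal.ofReal (m x) := by
  rw [massMeasure, Measure.sum_apply _ (MeasurableSet.of_discrete), tsum_eq_single x]
  · simp
  · intro y hy
    simp [hy]

/-- The real Hilbert space `ℓ²(V, m)`. -/
abbrev EllTwo {V : Type*} [MeasurableSpace V] (m : V → ℝ) : Type _ :=
  Lp ℝ 2 (massMeasure m)

/-- The element of `ℓ²(V, m)` given by the function that is `1` at `x` and `0` elsewhere. -/
noncomputable def deltaFun {V : Type*} [MeasurableSpace V] [DiscreteMeasurableSpace V]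
    (m : V → ℝ) (x : V) : EllTwo m :=
  indicatorConstLp 2 (MeasurableSet.of_discrete (s := {x}))
    (by rw [massMeasure_singleton]; exact ENNReal.ofReal_ne_top) 1

namespace WeightedGraph

/-- Any two vertices are joined by a path of edges of positive weight. -/
def Connected {V : Type*} (G : WeightedGraph V) : Prop :=
  ∀ x y, Relation.ReflTransGen (fun z w => 0 < G.b z w) x y

/-- The quadratic form `u ↦ ½ ∑ b(x,y) (u(x) - u(y))²`, with values in `[0, ∞]`. -/
noncomputable def energy {V : Type*} (G : WeightedGraph V) (u : V → ℝ) : ℝ≥0∞ :=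
  2⁻¹ * ∑' p : V × V, ENNReal.ofReal (G.b p.1 p.2 * (u p.1 - u p.2) ^ 2)

/-- `u` is a function of finite energy. -/
def FiniteEnergy {V : Type*} (G : WeightedGraph V) (u : V → ℝ) : Prop :=
  G.energy u < ⊤

/-- The bilinear form `½ ∑ b(x,y) (u(x) - u(y)) (v(x) - v(y))`; the sum converges absolutely when
`u` and `v` have finite energy. -/
noncomputable def form {V : Type*} (G : WeightedGraph V) (u v : V → ℝ) : ℝ :=
  2⁻¹ * ∑' p : V × V, G.b p.1 p.2 * (u p.1 - u p.2) * (v p.1 - v p.2)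

/-- The formal Laplacian `(1 / m(x)) ∑_y b(x,y) (u(x) - u(y))`; the sum converges absolutely when
`u` has finite energy. -/
noncomputable def formalLaplacian {V : Type*} (G : WeightedGraph V) (m : V → ℝ) (u : V → ℝ)
    (x : V) : ℝ :=
  (m x)⁻¹ * ∑' y, G.b x y * (u x - u y)

section

variable {V : Type*} [MeasurableSpace V]

/-- The domain of the regular Dirichlet form `Q^D`: the closure of the finitely supported functions
in `{u ∈ ℓ²(V, m) : u has finite energy}` for the form norm `(Q(u) + ‖u‖²)^(1/2)`. -/
def formDomain (G : WeightedGraph V) (m : V → ℝ) : Set (EllTwo m) :=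
  {u | G.FiniteEnergy u ∧ ∃ φ : ℕ → EllTwo m,
    (∀ n, (Function.support (φ n : V → ℝ)).Finite) ∧
    Tendsto (fun n => G.energy (u - φ n : EllTwo m) + ‖u - φ n‖ₑ ^ 2) atTop (𝓝 0)}

/-- `u` lies in the domain of the self-adjoint operator `L` associated with `Q^D`, and `L u = w`:
one has `u ∈ D(Q^D)` and `Q^D(u, v) = ⟨w, v⟩` for all `v ∈ D(Q^D)`. -/
def IsGeneratorValue (G : WeightedGraph V) (m : V → ℝ) (u w : EllTwo m) : Prop :=
  u ∈ G.formDomain m ∧ ∀ v ∈ G.formDomain m, G.form u v = inner ℝ w v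

/-- `T` (on positive times) is the semigroup `e^{-tL}` associated with `Q^D`: the strongly
continuous semigroup of self-adjoint contractions on `ℓ²(V, m)` which `L` generates, that is,
`L u = lim_{t → 0+} (u - T_t u) / t`, where `D(L)` is the set of all `u` for which the limit
exists. These properties determine `T t` for all `t > 0`. -/
structure IsAssociatedSemigroup (G : WeightedGraph V) (m : V → ℝ)
    (T : ℝ → EllTwo m →L[ℝ] EllTwo m) : Prop where
  symmetric : ∀ t, 0 < t → ∀ f g : EllTwo m, inner ℝ (T t f) g = inner ℝ f (T t g)
  semigroup : ∀ t s, 0 < t → 0 < s → ∀ f, T (t + s) f = T t (T s f)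
  contractive : ∀ t, 0 < t → ∀ f, ‖T t f‖ ≤ ‖f‖
  strongly_continuous : ∀ f, Tendsto (fun t => T t f) (𝓝[>] 0) (𝓝 f)
  generator : ∀ u w : EllTwo m,
    Tendsto (fun t : ℝ => t⁻¹ • (u - T t u)) (𝓝[>] 0) (𝓝 w) ↔ G.IsGeneratorValue m u w

/-- `Q^D` is recurrent: its semigroup `e^{-tL}` satisfies
`∫_0^∞ (e^{-tL} δ_x)(y) dt = ∞` for all vertices `x` and `y`. -/
def IsRecurrent [DiscreteMeasurableSpace V] (G : WeightedGraph V) (m : V → ℝ) : Prop :=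
  ∃ T : ℝ → EllTwo m →L[ℝ] EllTwo m, G.IsAssociatedSemigroup m T ∧
    ∀ x y : V, ∫⁻ t in Ioi (0 : ℝ), ENNReal.ofReal ((T t (deltaFun m x) : V → ℝ) y) = ⊤

end

end WeightedGraph

/-!
The link between recurrence and the Laplacian is the capacity of a vertex `o`: it is zero if
finitely supported functions with value close to `1` at `o` can have arbitrarily small energy.

*Capacity and the Laplacian.* If `o` has zero capacity, then, after truncation, there are finitely
supported `φₙ` with values in `[0, 1]`, `φₙ → 1` pointwise (by connectedness) and energy tending to
zero. Green's formula `∑ φₙ (L̃ u) m = Q(u, φₙ) → 0` and dominated convergence give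
`∑ (L̃ u) m = 0` (`Connected.tsum_formalLaplacian_eq_zero`). If `o` has positive capacity, then
projecting `(1, 0)` onto the closure of all `(φ o, ∇φ)` produces a function `u` of finite energy with
`Q(u, φ) = c φ(o)` for some `c ≠ 0` and all finitely supported `φ`, so `(L̃ u) m` is `c` times the
unit mass at `o` (`Connected.exists_green_of_not_zeroCapacityAt`).

*Capacity and recurrence.* Let `v = ∫₀ᴺ T_t δ_x dt`. Then `L v = δ_x - T_N δ_x`, and the energy of
`v` is at most `⟪δ_x, v⟫ = m(x) v(x)`. If `x` has positive capacity, then `v(x)` is at most a constant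
times the square root of the energy, so `v(x)` is bounded in `N`
(`zeroCapacityAt_of_lintegral_eq_top`). If `v(y)` is bounded above in `N` for some `y`, then so is
`v(x)`, because `|v(x) - v(y)|` is at most a constant times the square root of the energy. Hence
`T_N δ_x → 0` and `m(x) φ(x) = lim Q(v, φ)` is at most a constant times the square root of the energy
of `φ`, which excludes zero capacity (`lintegral_eq_top_of_zeroCapacityAt`). No positivity of the
semigroup is needed.

*Existence of the semigroup.* Recurrence includes the existence of `T`. The form `Q^D` is treated as
a closed subspace `Γ` of `ℓ²(V, m) × ℓ²(V × V)`, the closed graph of the gradient; its operator is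
self-adjoint (`isNonnegSelfAdjoint_formOperator`), and a non-negative self-adjoint operator generates
a semigroup, the limit of the exponentials of its Yosida approximations
(`IsNonnegSelfAdjoint.exists_semigroup`).
-/

/-! ### Exponentials of bounded dissipative operators -/

section Semigroup

open scoped InnerProductSpace

variable {H : Type*} [NormedAddCommGroup H] [InnerProductSpace ℝ H] [CompleteSpace H]

theorem hasDerivAt_exp_smul_apply (X : H →L[ℝ] H) (f : H) (t : ℝ) :
    HasDerivAt (fun s : ℝ => NormedSpace.exp (s • X) f) (X (NormedSpace.exp (t • X) f)) t := by
  have h := (ContinuousLinearMap.apply ℝ H f).hasFDerivAt.comp_hasDerivAt t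
    (hasDerivAt_exp_smul_const' (𝕂 := ℝ) X t)
  simpa [Function.comp_def] using h

theorem norm_exp_smul_apply_le {X : H →L[ℝ] H} (hX : ∀ g, ⟪X g, g⟫_ℝ ≤ 0) {t : ℝ} (ht : 0 ≤ t)
    (f : H) : ‖NormedSpace.exp (t • X) f‖ ≤ ‖f‖ := by
  have hd : ∀ s : ℝ, HasDerivAt (fun s : ℝ => ‖NormedSpace.exp (s • X) f‖ ^ 2)
      (2 * ⟪NormedSpace.exp (s • X) f, X (NormedSpace.exp (s • X) f)⟫_ℝ) s := fun s =>
    (hasDerivAt_exp_smul_apply X f s).norm_sq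
  have hanti : Antitone fun s : ℝ => ‖NormedSpace.exp (s • X) f‖ ^ 2 :=
    antitone_of_hasDerivAt_nonpos hd fun s => by
      have := hX (NormedSpace.exp (s • X) f)
      rw [real_inner_comm] at this
      simp only [Pi.zero_apply]
      linarith
  have h := hanti ht
  simp only [zero_smul, NormedSpace.exp_zero, one_apply_eq_self] at h
  exact (sq_le_sq₀ (norm_nonneg _) (norm_nonneg _)).1 h

/-- Two commuting contraction semigroups differ at time `t` by at most `t` times the difference of
their generators: the derivative of `s ↦ e^{sX} e^{(t-s)Y} f` is `e^{sX} e^{(t-s)Y} (X - Y) f`. -/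
theorem norm_exp_smul_sub_exp_smul_le {X Y : H →L[ℝ] H} (hX : ∀ g, ⟪X g, g⟫_ℝ ≤ 0)
    (hY : ∀ g, ⟪Y g, g⟫_ℝ ≤ 0) (hXY : Commute X Y) {t : ℝ} (ht : 0 ≤ t) (f : H) :
    ‖NormedSpace.exp (t • X) f - NormedSpace.exp (t • Y) f‖ ≤ ‖X f - Y f‖ * t := by
  let F : ℝ → H := fun s => NormedSpace.exp (s • X) (NormedSpace.exp ((t - s) • Y) f)
  have hF : ∀ s, HasDerivAt F
      (NormedSpace.exp (s • X) (NormedSpace.exp ((t - s) • Y) (X f - Y f))) s := by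
    intro s
    have h1 := hasDerivAt_exp_smul_const (𝕂 := ℝ) X s
    have h2 : HasDerivAt (fun s : ℝ => NormedSpace.exp ((t - s) • Y) f)
        (-(NormedSpace.exp ((t - s) • Y) (Y f))) s := by
      have h := (ContinuousLinearMap.apply ℝ H f).hasFDerivAt.comp_hasDerivAt (t - s)
        (hasDerivAt_exp_smul_const (𝕂 := ℝ) Y (t - s))
      have h' := h.scomp s ((hasDerivAt_id s).const_sub t)
      simpa [Function.comp_def] using h'
    have h3 := h1.clm_apply h2
    convert h3 using 1
    have hc : X (NormedSpace.exp ((t - s) • Y) f) = NormedSpace.exp ((t - s) • Y) (X f) :=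
      DFunLike.congr_fun ((hXY.smul_right (t - s)).exp_right).eq f
    simp only [mul_apply_eq_comp, hc, map_sub, map_neg]
    abel
  have h := norm_image_sub_le_of_norm_deriv_le_segment' (f := F) (a := 0) (b := t)
    (C := ‖X f - Y f‖) (fun s _ => (hF s).hasDerivWithinAt)
    (fun s hs => (norm_exp_smul_apply_le hX hs.1 _).trans
      (norm_exp_smul_apply_le hY (sub_nonneg.2 hs.2.le) _)) t ⟨ht, le_rfl⟩
  simpa [F] using h

theorem norm_exp_smul_sub_self_le {X : H →L[ℝ] H} (hX : ∀ g, ⟪X g, g⟫_ℝ ≤ 0) {t : ℝ}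
    (ht : 0 ≤ t) (f : H) : ‖NormedSpace.exp (t • X) f - f‖ ≤ ‖X f‖ * t := by
  simpa using norm_exp_smul_sub_exp_smul_le hX (Y := 0) (by simp) (Commute.zero_right X) ht f

/-- First order expansion: if the orbit of `X f` stays within `C` of `X f` up to time `t`, then
`e^{tX} f = f + t X f` up to an error `C t`. -/
theorem norm_exp_smul_sub_self_sub_le {X : H →L[ℝ] H} {t : ℝ} (ht : 0 ≤ t) (f : H) {C : ℝ}
    (hC : ∀ s, 0 ≤ s → s ≤ t → ‖NormedSpace.exp (s • X) (X f) - X f‖ ≤ C) :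
    ‖NormedSpace.exp (t • X) f - f - t • X f‖ ≤ C * t := by
  have hc : ∀ s : ℝ, X (NormedSpace.exp (s • X) f) = NormedSpace.exp (s • X) (X f) := fun s =>
    DFunLike.congr_fun (((Commute.refl X).smul_right s).exp_right).eq f
  have h := norm_image_sub_le_of_norm_deriv_le_segment'
    (f := fun s : ℝ => NormedSpace.exp (s • X) f - s • X f) (a := 0) (b := t) (C := C)
    (fun s _ => ((hasDerivAt_exp_smul_apply X f s).sub
      ((hasDerivAt_id s).smul_const (X f))).hasDerivWithinAt)
    (fun s hs => by rw [hc, one_smul]; exact hC s hs.1 hs.2.le) t ⟨ht, le_rfl⟩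
  simp only [zero_smul, NormedSpace.exp_zero, one_apply_eq_self, sub_zero] at h
  rwa [sub_right_comm]

end Semigroup

/-! ### Generation of semigroups by non-negative self-adjoint relations -/

section Generation

open scoped InnerProductSpace

variable {H : Type*} [NormedAddCommGroup H] [InnerProductSpace ℝ H]

/-- `A` is the graph of a non-negative self-adjoint operator. Self-adjointness of the symmetric
relation `A` is encoded by the solvability of `A u + c u = f` for all `c > 0`. -/
structure IsNonnegSelfAdjoint (A : Submodule ℝ (H × H)) : Prop where
  symmetric : ∀ p ∈ A, ∀ q ∈ A, ⟪p.2, q.1⟫_ℝ = ⟪p.1, q.2⟫_ℝ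
  nonneg : ∀ p ∈ A, 0 ≤ ⟪p.2, p.1⟫_ℝ
  exists_resolvent : ∀ c : ℝ, 0 < c → ∀ f : H, ∃ u : H, (u, f - c • u) ∈ A
  single_valued : ∀ w : H, ((0 : H), w) ∈ A → w = 0

namespace IsNonnegSelfAdjoint

variable {A : Submodule ℝ (H × H)} (hA : IsNonnegSelfAdjoint A)

include hA

theorem norm_resolvent_le {c : ℝ} (hc : 0 < c) {f u : H} (hu : (u, f - c • u) ∈ A) :
    ‖u‖ ≤ c⁻¹ * ‖f‖ := by
  have h := hA.nonneg _ hu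
  simp only [inner_sub_left, real_inner_smul_left, real_inner_self_eq_norm_sq] at h
  have h2 := real_inner_le_norm f u
  rcases (norm_nonneg u).eq_or_lt with h0 | h0
  · rw [← h0]; positivity
  · have : c * ‖u‖ ≤ ‖f‖ := le_of_mul_le_mul_right (by nlinarith) h0
    rw [inv_mul_eq_div, le_div_iff₀ hc]
    linarith

theorem resolvent_unique {c : ℝ} (hc : 0 < c) {f u v : H} (hu : (u, f - c • u) ∈ A)
    (hv : (v, f - c • v) ∈ A) : u = v := by
  have h := A.sub_mem hu hv
  have h' : (u - v, (0 : H) - c • (u - v)) ∈ A := by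
    convert h using 1
    simp only [Prod.mk_sub_mk, Prod.mk.injEq, true_and]
    module
  have := hA.norm_resolvent_le hc h'
  rw [norm_zero, mul_zero] at this
  exact sub_eq_zero.1 (norm_le_zero_iff.1 this)

/-- The resolvent `(A + c)⁻¹` as a bounded operator. -/
theorem exists_resolvent_clm {c : ℝ} (hc : 0 < c) :
    ∃ R : H →L[ℝ] H, (∀ f, (R f, f - c • R f) ∈ A) ∧ ∀ f, ‖R f‖ ≤ c⁻¹ * ‖f‖ := by
  choose r hr using hA.exists_resolvent c hc
  refine ⟨LinearMap.mkContinuous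
    { toFun := r
      map_add' := fun f g => hA.resolvent_unique hc (hr _) ?_
      map_smul' := fun a f => hA.resolvent_unique hc (hr _) ?_ } c⁻¹
    fun f => hA.norm_resolvent_le hc (hr f), hr, fun f => hA.norm_resolvent_le hc (hr f)⟩
  · convert A.add_mem (hr f) (hr g) using 1
    simp only [Prod.mk_add_mk, Prod.mk.injEq, true_and]
    module
  · convert A.smul_mem a (hr f) using 1
    simp only [Prod.smul_mk, Prod.mk.injEq, true_and, RingHom.id_apply]
    module

theorem dense_domain [CompleteSpace H] : Dense {u : H | ∃ w, (u, w) ∈ A} := by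
  have h : ({u : H | ∃ w, (u, w) ∈ A} : Set H) = (A.map (LinearMap.fst ℝ H H) : Submodule ℝ H) := by
    ext u; simp
  rw [h, Submodule.dense_iff_topologicalClosure_eq_top,
    Submodule.topologicalClosure_eq_top_iff, Submodule.eq_bot_iff]
  intro g hg
  obtain ⟨u, hu⟩ := hA.exists_resolvent 1 one_pos g
  have h1 : ⟪u, g⟫_ℝ = 0 := (Submodule.mem_orthogonal _ _).1 hg u ⟨_, hu, rfl⟩
  have h2 := hA.nonneg _ hu
  simp only [inner_sub_left, one_smul, real_inner_self_eq_norm_sq, real_inner_comm u g, h1] at h2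
  have h3 : u = 0 := norm_eq_zero.1 (by nlinarith [norm_nonneg u])
  subst h3
  exact hA.single_valued g (by simpa using hu)

/-- The Yosida approximations: bounded, symmetric, dissipative and commuting operators `X n`
which converge to `-A`, because `-X n` is `A` composed with the contraction `J n`, where
`J n = (n + 1) (A + n + 1)⁻¹` converges strongly to the identity. -/
theorem exists_yosida [CompleteSpace H] : ∃ X : ℕ → H →L[ℝ] H,
    (∀ n g, ⟪X n g, g⟫_ℝ ≤ 0) ∧ (∀ n, IsSelfAdjoint (X n)) ∧ (∀ n k, Commute (X n) (X k)) ∧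
    ∀ u w, (u, w) ∈ A → Tendsto (fun n => X n u) atTop (𝓝 (-w)) := by
  have hpos : ∀ n : ℕ, (0 : ℝ) < n + 1 := fun n => by positivity
  choose R hR hRn using fun n : ℕ => hA.exists_resolvent_clm (hpos n)
  have hRA : ∀ n u w, (u, w) ∈ A → u = R n (w + ((n : ℝ) + 1) • u) := fun n u w h =>
    hA.resolvent_unique (hpos n) (f := w + ((n : ℝ) + 1) • u) (by simpa using h) (hR n _)
  have hJ : ∀ (n : ℕ) (f : H), ‖((n : ℝ) + 1) • R n f‖ ≤ ‖f‖ := fun n f => by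
    rw [norm_smul, Real.norm_of_nonneg (hpos n).le]
    calc _ ≤ ((n : ℝ) + 1) * (((n : ℝ) + 1)⁻¹ * ‖f‖) :=
          mul_le_mul_of_nonneg_left (hRn n f) (hpos n).le
      _ = ‖f‖ := by field_simp
  have hsymm : ∀ n f g, ⟪R n f, g⟫_ℝ = ⟪f, R n g⟫_ℝ := fun n f g => by
    have h := hA.symmetric _ (hR n f) _ (hR n g)
    simp only [inner_sub_left, inner_sub_right, real_inner_smul_left, real_inner_smul_right] at h
    linarith
  have hcomm : ∀ n k f, R n (R k f) = R k (R n f) := fun n k f => by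
    rcases eq_or_ne n k with rfl | hnk
    · rfl
    have key : ∀ n k : ℕ, R k f = R n f + ((n : ℝ) - k) • R n (R k f) := fun n k => by
      have h := hRA n _ _ (hR k f)
      rw [sub_add_eq_add_sub, add_sub_assoc, ← sub_smul, map_add, map_smul] at h
      rw [show ((n : ℝ) - k) = (n + 1) - (k + 1) by ring]
      exact h
    have h1 := key n k
    have h2 := key k n
    have hne : ((n : ℝ) - k) ≠ 0 := sub_ne_zero.2 (by exact_mod_cast hnk)
    have h3 : ((n : ℝ) - k) • (R n (R k f) - R k (R n f)) = 0 := by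
      have h4 : ((n : ℝ) - k) • (R n (R k f) - R k (R n f)) =
          -(R k f - (R n f + ((n : ℝ) - k) • R n (R k f))) -
            (R n f - (R k f + ((k : ℝ) - n) • R k (R n f))) := by module
      rw [h4, sub_eq_zero.2 h1, sub_eq_zero.2 h2, neg_zero, sub_zero]
    exact sub_eq_zero.1 ((smul_eq_zero.1 h3).resolve_left hne)
  -- strong convergence `J n → 1`, first on the domain
  have hJlim : ∀ f, Tendsto (fun n : ℕ => ((n : ℝ) + 1) • R n f) atTop (𝓝 f) := by
    intro f
    rw [Metric.tendsto_atTop]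
    intro ε hε
    obtain ⟨g, ⟨w, hgw⟩, hg⟩ := hA.dense_domain.exists_dist_lt f (show 0 < ε / 3 by positivity)
    obtain ⟨N, hN⟩ := exists_nat_gt (‖w‖ / (ε / 3))
    refine ⟨N, fun n hn => ?_⟩
    have h1 : ‖((n : ℝ) + 1) • R n g - g‖ < ε / 3 := by
      have h := hRA n g w hgw
      rw [map_add, map_smul] at h
      have h' : ((n : ℝ) + 1) • R n g - g = -R n w := by
        nth_rewrite 2 [h]; abel
      rw [h', norm_neg]
      refine (hRn n w).trans_lt ?_
      rw [inv_mul_lt_iff₀ (hpos n)]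
      rw [div_lt_iff₀ (by positivity)] at hN
      have : (N : ℝ) ≤ n := by exact_mod_cast hn
      nlinarith
    have h2 : ‖((n : ℝ) + 1) • R n (f - g)‖ < ε / 3 :=
      (hJ n _).trans_lt (by rwa [← dist_eq_norm])
    rw [dist_eq_norm] at hg ⊢
    have : ((n : ℝ) + 1) • R n f - f = ((n : ℝ) + 1) • R n (f - g) +
        (((n : ℝ) + 1) • R n g - g) - (f - g) := by rw [map_sub]; module
    rw [this]
    linarith [norm_sub_le (((n : ℝ) + 1) • R n (f - g) + (((n : ℝ) + 1) • R n g - g)) (f - g),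
      norm_add_le (((n : ℝ) + 1) • R n (f - g)) (((n : ℝ) + 1) • R n g - g)]
  refine ⟨fun n => ((n : ℝ) + 1) • (((n : ℝ) + 1) • R n - 1), fun n g => ?_, fun n => ?_,
    fun n k => ?_, fun u w h => ?_⟩
  · have h := real_inner_le_norm (((n : ℝ) + 1) • R n g) g
    have h2 := mul_le_mul_of_nonneg_right (hJ n g) (norm_nonneg g)
    simp only [smul_apply, sub_apply, one_apply_eq_self, real_inner_smul_left (_ - _),
      inner_sub_left (_ • _), real_inner_self_eq_norm_sq]
    exact mul_nonpos_of_nonneg_of_nonpos (hpos n).le (by nlinarith)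
  · have hRs : IsSelfAdjoint (R n) :=
      (ContinuousLinearMap.isSelfAdjoint_iff_isSymmetric).2 fun f g => hsymm n f g
    exact IsSelfAdjoint.smul (by simp [IsSelfAdjoint])
      ((IsSelfAdjoint.smul (by simp [IsSelfAdjoint]) hRs).sub (.one _))
  · have : Commute (R n) (R k) := ContinuousLinearMap.ext fun f => hcomm n k f
    exact ((((this.smul_left _).smul_right _).sub_left (Commute.one_left _)).sub_right
      (Commute.one_right _)).smul_left _ |>.smul_right _
  · refine (hJlim w).neg.congr fun n => ?_
    have h := hRA n u w h
    rw [map_add, map_smul] at h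
    simp only [smul_apply, sub_apply, one_apply_eq_self]
    rw [eq_sub_of_add_eq h.symm, ← smul_neg, neg_sub]

end IsNonnegSelfAdjoint

end Generation

section SemigroupOfRelation

open scoped InnerProductSpace

variable {H : Type*} [NormedAddCommGroup H] [InnerProductSpace ℝ H]

/-- `T` (on positive times) is the strongly continuous semigroup of symmetric contractions with
generator `-A`, where `A` is given by its graph. -/
structure IsSemigroupGeneratedBy (A : Submodule ℝ (H × H)) (T : ℝ → H →L[ℝ] H) : Prop where
  symmetric : ∀ t, 0 < t → ∀ f g : H, ⟪T t f, g⟫_ℝ = ⟪f, T t g⟫_ℝ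
  semigroup : ∀ t s, 0 < t → 0 < s → ∀ f, T (t + s) f = T t (T s f)
  contractive : ∀ t, 0 < t → ∀ f, ‖T t f‖ ≤ ‖f‖
  strongly_continuous : ∀ f, Tendsto (fun t => T t f) (𝓝[>] 0) (𝓝 f)
  generator : ∀ u w : H, Tendsto (fun t : ℝ => t⁻¹ • (u - T t u)) (𝓝[>] 0) (𝓝 w) ↔ (u, w) ∈ A

namespace IsNonnegSelfAdjoint

variable {A : Submodule ℝ (H × H)} (hA : IsNonnegSelfAdjoint A)

include hA

/-- A symmetric relation extending a self-adjoint one coincides with it. -/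
theorem mem_of_symmetric {u w : H} (h : ∀ p ∈ A, ⟪w, p.1⟫_ℝ = ⟪u, p.2⟫_ℝ) : (u, w) ∈ A := by
  obtain ⟨v, hv⟩ := hA.exists_resolvent 1 one_pos (u + w)
  rw [one_smul] at hv
  suffices u = v by subst this; simpa using hv
  obtain ⟨z, hz⟩ := hA.exists_resolvent 1 one_pos (u - v)
  rw [one_smul] at hz
  have h1 := h _ hz
  have h2 := hA.symmetric _ hv _ hz
  have h3 : ⟪u - v, u - v⟫_ℝ = 0 := by
    simp only [inner_sub_left, inner_sub_right, inner_add_left] at h1 h2 ⊢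
    have := real_inner_comm u v
    linarith
  exact sub_eq_zero.1 (inner_self_eq_zero.1 h3)

theorem exists_semigroup [CompleteSpace H] :
    ∃ T : ℝ → H →L[ℝ] H, IsSemigroupGeneratedBy A T := by
  obtain ⟨X, hX, hXs, hXc, hXA⟩ := hA.exists_yosida
  have hS : ∀ (n : ℕ) {t : ℝ}, 0 ≤ t → ∀ f, ‖NormedSpace.exp (t • X n) f‖ ≤ ‖f‖ :=
    fun n t ht f => norm_exp_smul_apply_le (hX n) ht f
  have hex : ∀ t : ℝ, ∃ T : H →L[ℝ] H, 0 ≤ t →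
      ∀ f, Tendsto (fun n => NormedSpace.exp (t • X n) f) atTop (𝓝 (T f)) := by
    intro t
    by_cases ht : 0 ≤ t
    swap
    · exact ⟨0, fun h => absurd h ht⟩
    have hc : ∀ f, ∃ y, Tendsto (fun n => NormedSpace.exp (t • X n) f) atTop (𝓝 y) := by
      refine fun f => cauchySeq_tendsto_of_complete (Metric.cauchySeq_iff'.2 fun ε hε => ?_)
      obtain ⟨g, ⟨w, hgw⟩, hg⟩ := hA.dense_domain.exists_dist_lt f (show 0 < ε / 3 by positivity)
      obtain ⟨N, hN⟩ := Metric.cauchySeq_iff'.1 (hXA g w hgw).cauchySeq (ε / 3 / (t + 1))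
        (by positivity)
      refine ⟨N, fun n hn => ?_⟩
      have h1 := norm_exp_smul_sub_exp_smul_le (hX n) (hX N) (hXc n N) ht g
      have h2 := hN n hn
      rw [dist_eq_norm, lt_div_iff₀ (by positivity)] at h2
      rw [dist_eq_norm] at hg ⊢
      have h3 := hS n ht (f - g)
      have h4 := hS N ht (f - g)
      have h5 : NormedSpace.exp (t • X n) f - NormedSpace.exp (t • X N) f =
          NormedSpace.exp (t • X n) (f - g) +
          (NormedSpace.exp (t • X n) g - NormedSpace.exp (t • X N) g) -
          NormedSpace.exp (t • X N) (f - g) := by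
        rw [map_sub, map_sub]; abel
      rw [h5]
      have h6 := norm_nonneg (X n g - X N g)
      calc _ ≤ _ := (norm_sub_le _ _).trans (add_le_add_left (norm_add_le _ _) _)
        _ < ε := by nlinarith
    choose y hy using hc
    exact ⟨continuousLinearMapOfTendsto (𝕜₁ := ℝ) (𝕜₂ := ℝ) (σ₁₂ := RingHom.id ℝ)
      (fun n => NormedSpace.exp (t • X n)) (tendsto_pi_nhds.2 hy), fun _ => hy⟩
  choose T hT using hex
  have hTn : ∀ t, 0 ≤ t → ∀ f, ‖T t f‖ ≤ ‖f‖ := fun t ht f =>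
    le_of_tendsto (hT t ht f).norm (Eventually.of_forall fun n => hS n ht f)
  have hTsymm : ∀ t, 0 ≤ t → ∀ f g : H, ⟪T t f, g⟫_ℝ = ⟪f, T t g⟫_ℝ := fun t ht f g => by
    refine tendsto_nhds_unique ((hT t ht f).inner tendsto_const_nhds)
      ((tendsto_const_nhds.inner (hT t ht g)).congr fun n => ?_)
    have : IsSelfAdjoint (NormedSpace.exp (t • X n)) :=
      (IsSelfAdjoint.smul (by simp [IsSelfAdjoint]) (hXs n)).exp
    exact ((ContinuousLinearMap.isSelfAdjoint_iff_isSymmetric.1 this) f g).symm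
  have hTdom : ∀ u w, (u, w) ∈ A → ∀ t, 0 ≤ t → ‖T t u - u‖ ≤ ‖w‖ * t := fun u w h t ht => by
    have h1 := (hXA u w h).norm.mul_const t
    rw [norm_neg] at h1
    exact le_of_tendsto_of_tendsto' ((hT t ht u).sub_const u).norm h1
      fun n => norm_exp_smul_sub_self_le (hX n) ht u
  have hTcont : ∀ f, Tendsto (fun t => T t f) (𝓝[>] 0) (𝓝 f) := by
    intro f
    rw [Metric.tendsto_nhds]
    intro ε hε
    obtain ⟨g, ⟨w, hgw⟩, hg⟩ := hA.dense_domain.exists_dist_lt f (show 0 < ε / 3 by positivity)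
    rw [dist_eq_norm] at hg
    have : Ioo (0 : ℝ) (ε / 3 / (‖w‖ + 1)) ∈ 𝓝[>] (0 : ℝ) := Ioo_mem_nhdsGT (by positivity)
    filter_upwards [this] with t ht
    have h1 := hTdom g w hgw t ht.1.le
    have h2 := ht.2
    rw [lt_div_iff₀ (by positivity)] at h2
    have h3 := hTn t ht.1.le (f - g)
    have h4 : T t f - f = T t (f - g) + (T t g - g) - (f - g) := by rw [map_sub]; abel
    rw [dist_eq_norm, h4]
    calc _ ≤ _ := (norm_sub_le _ _).trans (add_le_add_left (norm_add_le _ _) _)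
      _ < ε := by nlinarith [ht.1]
  -- first order expansion on the domain
  have hTgen : ∀ u w, (u, w) ∈ A →
      Tendsto (fun t : ℝ => t⁻¹ • (u - T t u)) (𝓝[>] 0) (𝓝 w) := by
    intro u w huw
    rw [Metric.tendsto_nhds]
    intro ε hε
    obtain ⟨g, ⟨z, hgz⟩, hg⟩ := hA.dense_domain.exists_dist_lt w (show 0 < ε / 4 by positivity)
    rw [dist_eq_norm] at hg
    have : Ioo (0 : ℝ) (ε / 4 / (‖z‖ + 1)) ∈ 𝓝[>] (0 : ℝ) := Ioo_mem_nhdsGT (by positivity)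
    filter_upwards [this] with t ht
    have h2 := ht.2
    rw [lt_div_iff₀ (by positivity)] at h2
    have key : ‖T t u - u - t • (-w)‖ ≤ (‖z‖ * t + 2 * ‖w - g‖) * t := by
      have hl : Tendsto (fun n => (‖X n g‖ * t + 2 * ‖-X n u - g‖) * t) atTop
          (𝓝 ((‖-z‖ * t + 2 * ‖-(-w) - g‖) * t)) :=
        (((hXA g z hgz).norm.mul_const t).add
          (((hXA u w huw).neg.sub_const g).norm.const_mul 2)).mul_const t
      rw [norm_neg, neg_neg] at hl
      refine le_of_tendsto_of_tendsto' (((hT t ht.1.le u).sub_const u).sub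
        ((hXA u w huw).const_smul t)).norm hl fun n => ?_
      refine norm_exp_smul_sub_self_sub_le ht.1.le u fun s hs0 hs => ?_
      have h5 := norm_exp_smul_sub_self_le (hX n) hs0 g
      have h6 := hS n hs0 (-X n u - g)
      have h7 : NormedSpace.exp (s • X n) (X n u) - X n u =
          (-X n u - g) - NormedSpace.exp (s • X n) (-X n u - g) -
            (NormedSpace.exp (s • X n) g - g) := by
        rw [map_sub, map_neg]; abel
      rw [h7]
      have h8 := mul_le_mul_of_nonneg_left hs (norm_nonneg (X n g))
      calc _ ≤ _ := (norm_sub_le _ _).trans (add_le_add_left (norm_sub_le _ _) _)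
        _ ≤ _ := by linarith
    have h9 : t⁻¹ • (u - T t u) - w = -(t⁻¹ • (T t u - u - t • (-w))) := by
      have := ht.1.ne'
      rw [smul_sub _ (T t u - u), smul_smul, inv_mul_cancel₀ this]
      module
    rw [dist_eq_norm, h9, norm_neg, norm_smul, Real.norm_of_nonneg (inv_nonneg.2 ht.1.le),
      inv_mul_lt_iff₀ ht.1]
    refine key.trans_lt ?_
    rw [mul_comm t]
    exact mul_lt_mul_of_pos_right (by nlinarith [ht.1]) ht.1
  refine ⟨T, fun t ht => hTsymm t ht.le, fun t s ht hs f => ?_, fun t ht => hTn t ht.le, hTcont,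
    fun u w => ⟨fun h => ?_, hTgen u w⟩⟩
  · refine tendsto_nhds_unique (hT (t + s) (by positivity) f) ?_
    have h1 : Tendsto (fun n => NormedSpace.exp (t • X n) (NormedSpace.exp (s • X n) f - T s f))
        atTop (𝓝 0) := by
      refine squeeze_zero_norm (fun n => hS n ht.le _) ?_
      simpa using ((hT s hs.le f).sub_const (T s f)).norm
    have h2 := h1.add (hT t ht.le (T s f))
    rw [zero_add] at h2
    refine h2.congr fun n => ?_
    let _ : NormedAlgebra ℚ (H →L[ℝ] H) := NormedAlgebra.restrictScalars ℚ ℝ (H →L[ℝ] H)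
    rw [map_sub, sub_add_cancel, add_smul, NormedSpace.exp_add_of_commute
      (((Commute.refl (X n)).smul_left t).smul_right s)]
    rfl
  · refine hA.mem_of_symmetric fun p hp => ?_
    refine tendsto_nhds_unique (h.inner tendsto_const_nhds)
      ((tendsto_const_nhds.inner (hTgen p.1 p.2 hp)).congr' ?_)
    filter_upwards [self_mem_nhdsWithin] with t ht
    rw [real_inner_smul_left, real_inner_smul_right, inner_sub_left, inner_sub_right,
      hTsymm t (le_of_lt ht)]

end IsNonnegSelfAdjoint

end SemigroupOfRelation

/-! ### Time integrals of a semigroup -/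

section TimeIntegral

open scoped InnerProductSpace

variable {H : Type*} [NormedAddCommGroup H] [InnerProductSpace ℝ H]

namespace IsSemigroupGeneratedBy

variable {A : Submodule ℝ (H × H)} {T : ℝ → H →L[ℝ] H} (hT : IsSemigroupGeneratedBy A T)

include hT

/-- The orbit of `f`, reflected to negative times, is continuous; its value at time `0` is `f`,
whatever the operator `T 0` is. -/
theorem continuous_orbit (f : H) : Continuous fun t : ℝ => if t = 0 then f else T |t| f := by
  set g : ℝ → H := fun t => if t = 0 then f else T |t| f with hg
  have hg0 : g 0 = f := by simp [hg]
  have habs : ∀ t, g |t| = g t := fun t => by simp [hg]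
  have h0 : Tendsto g (𝓝 0) (𝓝 f) := by
    have h1 : Tendsto g (𝓝[≠] 0) (𝓝 f) := by
      have h2 : Tendsto (fun t : ℝ => |t|) (𝓝[≠] 0) (𝓝[>] 0) := by
        refine tendsto_nhdsWithin_of_tendsto_nhds_of_eventually_within _ ?_ ?_
        · simpa using (continuous_abs.tendsto (0 : ℝ)).mono_left nhdsWithin_le_nhds
        · filter_upwards [self_mem_nhdsWithin] with t ht
          exact abs_pos.2 ht
      refine ((hT.strongly_continuous f).comp h2).congr' ?_
      filter_upwards [self_mem_nhdsWithin] with t ht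
      simp only [mem_compl_iff, mem_singleton_iff] at ht
      simp [hg, ht]
    have := continuousAt_iff_punctured_nhds.2 (hg0 ▸ h1 : Tendsto g (𝓝[≠] 0) (𝓝 (g 0)))
    simpa [ContinuousAt, hg0] using this
  -- the modulus of continuity at `0` is one at every time
  have hmono : ∀ a b : ℝ, 0 ≤ a → a ≤ b → ‖g b - g a‖ ≤ ‖g (b - a) - f‖ := by
    intro a b ha hab
    rcases ha.eq_or_lt with rfl | ha
    · simp [hg0]
    rcases hab.eq_or_lt with rfl | hab
    · simp
    have h1 : g b = T a (T (b - a) f) := by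
      have := hT.semigroup a (b - a) ha (sub_pos.2 hab) f
      rw [add_sub_cancel] at this
      simp [hg, (ha.trans hab).ne', abs_of_pos (ha.trans hab), this]
    have h2 : g a = T a f := by simp [hg, ha.ne', abs_of_pos ha]
    have h3 : g (b - a) = T (b - a) f := by
      simp [hg, (sub_pos.2 hab).ne', abs_of_pos (sub_pos.2 hab)]
    rw [h1, h2, h3, ← map_sub]
    exact hT.contractive a ha _
  have hbound : ∀ s t : ℝ, ‖g t - g s‖ ≤ ‖g (|t| - |s|) - f‖ := by
    intro s t
    rcases le_total |s| |t| with h | h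
    · simpa [habs] using hmono _ _ (abs_nonneg s) h
    · have := hmono _ _ (abs_nonneg t) h
      rw [habs, habs, ← habs (|s| - |t|), abs_sub_comm, habs] at this
      rwa [norm_sub_rev]
  refine continuous_iff_continuousAt.2 fun s => tendsto_iff_norm_sub_tendsto_zero.2 ?_
  refine squeeze_zero (fun t => norm_nonneg _) (hbound s) ?_
  have h4 : Tendsto (fun t : ℝ => |t| - |s|) (𝓝 s) (𝓝 0) := by
    simpa using (continuous_abs.tendsto s).sub_const |s|
  simpa using ((h0.comp h4).sub_const f).norm

theorem intervalIntegrable (f : H) {N : ℝ} (hN : 0 ≤ N) :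
    IntervalIntegrable (fun t => T t f) volume 0 N := by
  refine ((hT.continuous_orbit f).intervalIntegrable 0 N).congr fun t ht => ?_
  rw [uIoc_of_le hN] at ht
  simp [ht.1.ne', abs_of_pos ht.1]

theorem inner_integral (f g : H) {N : ℝ} (hN : 0 ≤ N) [CompleteSpace H] :
    ⟪g, ∫ t in 0..N, T t f⟫_ℝ = ∫ t in 0..N, ⟪g, T t f⟫_ℝ :=
  ((innerSL ℝ g).intervalIntegral_comp_comm (hT.intervalIntegrable f hN)).symm

theorem intervalIntegrable_inner (f g : H) {N : ℝ} (hN : 0 ≤ N) :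
    IntervalIntegrable (fun t => ⟪g, T t f⟫_ℝ) volume 0 N := by
  rw [intervalIntegrable_iff, uIoc_of_le hN]
  have := (intervalIntegrable_iff.1 (hT.intervalIntegrable f hN))
  rw [uIoc_of_le hN] at this
  exact this.const_inner g

/-- The time integral `v = ∫₀ᴺ T t f dt` solves `A v = f - T N f`. -/
theorem integral_mem [CompleteSpace H] (f : H) {N : ℝ} (hN : 0 < N) :
    (∫ t in 0..N, T t f, f - T N f) ∈ A := by
  refine (hT.generator _ _).1 ?_
  set g : ℝ → H := fun t => if t = 0 then f else T |t| f with hg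
  have hgc : Continuous g := hT.continuous_orbit f
  have hgT : ∀ t, 0 < t → g t = T t f := fun t ht => by simp [hg, ht.ne', abs_of_pos ht]
  have hg0 : g 0 = f := by simp [hg]
  have hΦ : ∀ x, HasDerivAt (fun x => ∫ t in 0..x, g t) (g x) x := fun x =>
    intervalIntegral.integral_hasDerivAt_right (hgc.intervalIntegrable _ _)
      hgc.stronglyMeasurable.stronglyMeasurableAtFilter hgc.continuousAt
  have h1 := (hΦ 0).tendsto_slope_zero_right.sub (hΦ N).tendsto_slope_zero_right
  rw [hg0, hgT N hN] at h1
  refine h1.congr' ?_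
  filter_upwards [self_mem_nhdsWithin] with ε hε
  have hε : 0 < ε := hε
  have h2 : ∫ t in 0..N, T t f = ∫ t in 0..N, g t :=
    intervalIntegral.integral_congr_ae (Eventually.of_forall fun t ht => by
      rw [uIoc_of_le hN.le] at ht; exact (hgT t ht.1).symm)
  have h3 : T ε (∫ t in 0..N, T t f) = ∫ t in ε..(N + ε), g t := by
    rw [← (T ε).intervalIntegral_comp_comm (hT.intervalIntegrable f hN.le)]
    have := intervalIntegral.integral_comp_add_right (a := 0) (b := N) g ε
    rw [zero_add] at this
    rw [← this]
    refine intervalIntegral.integral_congr_ae (Eventually.of_forall fun t ht => ?_)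
    rw [uIoc_of_le hN.le] at ht
    have hpos : 0 < t + ε := add_pos ht.1 hε
    rw [hgT _ hpos, add_comm, hT.semigroup ε t hε ht.1]
  have h4 := intervalIntegral.integral_add_adjacent_intervals
    (hgc.intervalIntegrable (μ := volume) 0 ε) (hgc.intervalIntegrable ε (N + ε))
  rw [h3, h2, zero_add, intervalIntegral.integral_same, sub_zero, ← smul_sub, ← h4]
  congr 1
  abel

theorem inner_orbit_add (f : H) {s t : ℝ} (hs : 0 < s) (ht : 0 < t) :
    ⟪f, T (s + t) f⟫_ℝ = ⟪T s f, T t f⟫_ℝ := by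
  rw [hT.semigroup s t hs ht, hT.symmetric s hs]

theorem inner_orbit_eq_norm_sq (f : H) {t : ℝ} (ht : 0 < t) :
    ⟪f, T (t + t) f⟫_ℝ = ‖T t f‖ ^ 2 := by
  rw [hT.inner_orbit_add f ht ht, real_inner_self_eq_norm_sq]

theorem inner_orbit_nonneg (f : H) {t : ℝ} (ht : 0 < t) : 0 ≤ ⟪f, T t f⟫_ℝ := by
  rw [← add_halves t, hT.inner_orbit_eq_norm_sq f (half_pos ht)]
  positivity

theorem norm_orbit_le (f : H) {s t : ℝ} (hs : 0 < s) (hst : s ≤ t) : ‖T t f‖ ≤ ‖T s f‖ := by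
  rcases hst.eq_or_lt with rfl | h
  · exact le_rfl
  · have := hT.semigroup (t - s) s (sub_pos.2 h) hs f
    rw [sub_add_cancel] at this
    rw [this]
    exact hT.contractive _ (sub_pos.2 h) _

/-- The time integral `v` of the orbit of `f` has form energy `⟪A v, v⟫` at most `⟪f, v⟫`. -/
theorem inner_sub_integral_le [CompleteSpace H] (f : H) {N : ℝ} (hN : 0 < N) :
    ⟪f - T N f, ∫ t in 0..N, T t f⟫_ℝ ≤ ⟪f, ∫ t in 0..N, T t f⟫_ℝ := by
  rw [inner_sub_left, sub_le_self_iff, hT.inner_integral _ _ hN.le]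
  refine intervalIntegral.integral_nonneg_of_ae_restrict hN.le ?_
  rw [EventuallyLE, ← Measure.restrict_congr_set Ioc_ae_eq_Icc, ae_restrict_iff' measurableSet_Ioc]
  refine Eventually.of_forall fun t ht => ?_
  rw [← hT.inner_orbit_add f hN ht.1]
  exact hT.inner_orbit_nonneg f (add_pos hN ht.1)

/-- If the integrals `∫₀ᴺ ⟪f, T t f⟫ dt` stay bounded, then `T N f → 0`, since the integrand is
decreasing in `t`. -/
theorem tendsto_orbit_zero [CompleteSpace H] (f : H) {K : ℝ}
    (hK : ∀ N, 0 < N → ⟪f, ∫ t in 0..N, T t f⟫_ℝ ≤ K) : Tendsto (fun N => T N f) atTop (𝓝 0) := by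
  have h : ∀ N, 0 < N → ‖T N f‖ ^ 2 ≤ K / N := by
    intro N hN
    rw [le_div_iff₀ hN]
    refine le_trans ?_ (hK N hN)
    rw [hT.inner_integral _ _ hN.le]
    have h1 : ∫ t in 0..N, ‖T N f‖ ^ 2 = ‖T N f‖ ^ 2 * N := by
      rw [intervalIntegral.integral_const, smul_eq_mul, sub_zero, mul_comm]
    rw [← h1]
    refine intervalIntegral.integral_mono_on_of_le_Ioo hN.le (by simp)
      (hT.intervalIntegrable_inner f f hN.le) fun t ht => ?_
    rw [← add_halves t, hT.inner_orbit_eq_norm_sq f (half_pos ht.1)]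
    have := hT.norm_orbit_le f (half_pos ht.1) (t := N) (by linarith [ht.1, ht.2])
    gcongr
  rw [tendsto_zero_iff_norm_tendsto_zero]
  have h2 : Tendsto (fun N : ℝ => √(K / N)) atTop (𝓝 0) := by
    simpa using (tendsto_const_nhds.div_atTop tendsto_id : Tendsto (fun N : ℝ => K / N) _ _).sqrt
  refine tendsto_of_tendsto_of_tendsto_of_le_of_le' tendsto_const_nhds h2
    (Eventually.of_forall fun N => norm_nonneg _) ?_
  filter_upwards [eventually_gt_atTop 0] with N hN
  exact Real.le_sqrt_of_sq_le (h N hN)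

end IsSemigroupGeneratedBy

end TimeIntegral

/-! ### The operator of a closed form -/

section ClosedForm

open scoped InnerProductSpace

variable {H K : Type*} [NormedAddCommGroup H] [InnerProductSpace ℝ H]
  [NormedAddCommGroup K] [InnerProductSpace ℝ K]

/-- The operator of the quadratic form `u ↦ ‖h‖²` for `(u, h) ∈ Γ`, where `Γ` is the graph of a
"gradient" from `H` to `K`: `A u = w` if and only if `⟪h, k⟫ = ⟪w, v⟫` for all `(v, k) ∈ Γ`. -/
def formOperator (Γ : Submodule ℝ (H × K)) : Submodule ℝ (H × H) where
  carrier := {p | ∃ h, (p.1, h) ∈ Γ ∧ ∀ q ∈ Γ, ⟪h, q.2⟫_ℝ = ⟪p.2, q.1⟫_ℝ}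
  add_mem' := by
    rintro p q ⟨h, hp, hp'⟩ ⟨k, hq, hq'⟩
    refine ⟨h + k, Γ.add_mem hp hq, fun r hr => ?_⟩
    simp only [Prod.snd_add, inner_add_left, hp' r hr, hq' r hr]
  zero_mem' := ⟨0, Γ.zero_mem, by simp⟩
  smul_mem' := by
    rintro c p ⟨h, hp, hp'⟩
    refine ⟨c • h, Γ.smul_mem c hp, fun r hr => ?_⟩
    simp only [Prod.smul_snd, real_inner_smul_left, hp' r hr]

theorem mem_formOperator {Γ : Submodule ℝ (H × K)} {u w : H} :
    (u, w) ∈ formOperator Γ ↔ ∃ h, (u, h) ∈ Γ ∧ ∀ q ∈ Γ, ⟪h, q.2⟫_ℝ = ⟪w, q.1⟫_ℝ := Iff.rfl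

variable [CompleteSpace H] [CompleteSpace K]

/-- The operator of a closed densely defined form is self-adjoint: the resolvent equation is solved
by orthogonal projection onto the graph, in the Hilbert space norm `(c ‖u‖² + ‖h‖²)^(1/2)`. -/
theorem isNonnegSelfAdjoint_formOperator {Γ : Submodule ℝ (H × K)}
    (hΓ : IsClosed (Γ : Set (H × K))) (hd : ∀ f : H, (∀ q ∈ Γ, ⟪f, q.1⟫_ℝ = 0) → f = 0) :
    IsNonnegSelfAdjoint (formOperator Γ) where
  symmetric := by
    rintro ⟨u, w⟩ ⟨h, hp, hp'⟩ ⟨v, z⟩ ⟨k, hq, hq'⟩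
    rw [← hp' _ hq, real_inner_comm, hq' _ hp, real_inner_comm]
  nonneg := by
    rintro ⟨u, w⟩ ⟨h, hp, hp'⟩
    rw [← hp' _ hp]
    exact real_inner_self_nonneg
  single_valued := by
    rintro w ⟨h, hp, hp'⟩
    have h0 : h = 0 := inner_self_eq_zero.1 ((hp' _ hp).trans (inner_zero_right _))
    exact hd w fun q hq => by rw [← hp' q hq, h0, inner_zero_left]
  exists_resolvent := by
    intro c hc f
    have hs : 0 < √c := Real.sqrt_pos.2 hc
    let S : WithLp 2 (H × K) →L[ℝ] H × K :=
      (((√c)⁻¹ • ContinuousLinearMap.fst ℝ H K).prod (ContinuousLinearMap.snd ℝ H K)).comp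
        (WithLp.prodContinuousLinearEquiv 2 ℝ H K : WithLp 2 (H × K) →L[ℝ] H × K)
    let M : Submodule ℝ (WithLp 2 (H × K)) := Γ.comap (S : WithLp 2 (H × K) →ₗ[ℝ] H × K)
    have hM : IsClosed (M : Set (WithLp 2 (H × K))) := hΓ.preimage S.continuous
    have : CompleteSpace M := hM.completeSpace_coe
    set p := M.starProjection (WithLp.toLp 2 ((√c)⁻¹ • f, (0 : K))) with hp
    have hpM : S p ∈ Γ := M.starProjection_apply_mem _
    refine ⟨(√c)⁻¹ • p.ofLp.1, p.ofLp.2, hpM, fun q hq => ?_⟩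
    have hqM : WithLp.toLp 2 (√c • q.1, q.2) ∈ M := by
      change ((√c)⁻¹ • √c • q.1, q.2) ∈ Γ
      rwa [smul_smul, inv_mul_cancel₀ hs.ne', one_smul]
    have h := M.starProjection_inner_eq_zero (WithLp.toLp 2 ((√c)⁻¹ • f, (0 : K))) _ hqM
    rw [← hp, WithLp.prod_inner_apply] at h
    simp only [WithLp.ofLp_sub, Prod.fst_sub, Prod.snd_sub, zero_sub,
      inner_neg_left, inner_sub_left, real_inner_smul_left, real_inner_smul_right] at h ⊢
    have hcc : c = √c * √c := (Real.mul_self_sqrt hc.le).symm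
    have e1 : (√c)⁻¹ * (√c * ⟪f, q.1⟫_ℝ) = ⟪f, q.1⟫_ℝ := by field_simp
    have e2 : c * ((√c)⁻¹ * ⟪p.ofLp.1, q.1⟫_ℝ) = √c * ⟪p.ofLp.1, q.1⟫_ℝ := by
      nth_rewrite 1 [hcc]; field_simp
    rw [e2]
    linarith

omit [CompleteSpace H] in
/-- For linear maps `ℓ : E → ℝ` and `D : E → K`, either `ℓ` can be `1` up to a small error while
`D` is small, or `c ℓ` with some `c ≠ 0` is represented by a vector `h` in the closure of the range
of `D`. The vector comes from the orthogonal projection of `(1, 0)` onto the closure of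
`{(ℓ φ, D φ)}`. -/
theorem mem_closure_or_exists_representation {E : Type*} [AddCommGroup E] [Module ℝ E]
    (ℓ : E →ₗ[ℝ] ℝ) (D : E →ₗ[ℝ] K) :
    ((1 : ℝ), (0 : K)) ∈ closure (range fun φ => (ℓ φ, D φ)) ∨
      ∃ (c : ℝ) (h : K), c ≠ 0 ∧ (∃ a, (a, h) ∈ closure (range fun φ => (ℓ φ, D φ))) ∧
        ∀ φ, ⟪h, D φ⟫_ℝ = c * ℓ φ := by
  let e := WithLp.prodContinuousLinearEquiv 2 ℝ ℝ K
  let M : Submodule ℝ (WithLp 2 (ℝ × K)) :=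
    (LinearMap.range (ℓ.prod D)).topologicalClosure.comap (e : WithLp 2 (ℝ × K) →ₗ[ℝ] ℝ × K)
  have hM : IsClosed (M : Set (WithLp 2 (ℝ × K))) :=
    (Submodule.isClosed_topologicalClosure _).preimage e.continuous
  have : CompleteSpace M := hM.completeSpace_coe
  have hcl : ∀ x : ℝ × K, x ∈ (LinearMap.range (ℓ.prod D)).topologicalClosure ↔
      x ∈ closure (range fun φ => (ℓ φ, D φ)) := fun x => Iff.rfl
  set p := M.starProjection (WithLp.toLp 2 ((1 : ℝ), (0 : K))) with hp
  have hpM : (p.ofLp.1, p.ofLp.2) ∈ closure (range fun φ => (ℓ φ, D φ)) :=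
    (hcl _).1 (M.starProjection_apply_mem (WithLp.toLp 2 ((1 : ℝ), (0 : K))))
  have key : ∀ q : ℝ × K, q ∈ closure (range fun φ => (ℓ φ, D φ)) →
      ⟪p.ofLp.2, q.2⟫_ℝ = (1 - p.ofLp.1) * q.1 := by
    intro q hq
    have hqM : WithLp.toLp 2 q ∈ M := (hcl q).2 hq
    have h := M.starProjection_inner_eq_zero (WithLp.toLp 2 ((1 : ℝ), (0 : K))) _ hqM
    rw [← hp, WithLp.prod_inner_apply] at h
    simp only [WithLp.ofLp_sub, Prod.fst_sub, Prod.snd_sub, zero_sub,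
      inner_neg_left, RCLike.inner_apply, conj_trivial] at h
    linarith
  by_cases hc : 1 - p.ofLp.1 = 0
  · left
    have h1 : p.ofLp.1 = 1 := by linarith
    have h0 : p.ofLp.2 = 0 := inner_self_eq_zero.1 ((key _ hpM).trans (by rw [hc, zero_mul]))
    rwa [h1, h0] at hpM
  · exact Or.inr ⟨1 - p.ofLp.1, p.ofLp.2, hc, ⟨_, hpM⟩, fun φ => key (ℓ φ, D φ)
      (subset_closure ⟨φ, rfl⟩)⟩

end ClosedForm

/-! ### Gradients of functions on a weighted graph -/

/-- The Hilbert space of square summable functions on pairs of vertices. -/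
abbrev EdgeSpace (V : Type*) : Type _ := lp (fun _ : V × V => ℝ) 2

namespace WeightedGraph

open scoped InnerProductSpace

variable {V : Type*} (G : WeightedGraph V)

/-- `h` is the gradient of `u`, normalized such that `‖h‖²` is the energy of `u`. Since `h` is
square summable, having a gradient means having finite energy. -/
def IsGradient (u : V → ℝ) (h : EdgeSpace V) : Prop :=
  ∀ p, h p = √(G.b p.1 p.2 / 2) * (u p.1 - u p.2)

variable {G}

theorem mul_gradient_eq (u v : V → ℝ) (p : V × V) :
    (√(G.b p.1 p.2 / 2) * (u p.1 - u p.2)) * (√(G.b p.1 p.2 / 2) * (v p.1 - v p.2)) =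
      2⁻¹ * (G.b p.1 p.2 * (u p.1 - u p.2) * (v p.1 - v p.2)) := by
  have := Real.mul_self_sqrt (div_nonneg (G.nonneg p.1 p.2) zero_le_two)
  linear_combination ((u p.1 - u p.2) * (v p.1 - v p.2)) * this

theorem IsGradient.add {u v : V → ℝ} {h k : EdgeSpace V} (hu : G.IsGradient u h)
    (hv : G.IsGradient v k) : G.IsGradient (u + v) (h + k) := fun p => by
  rw [lp.coeFn_add, Pi.add_apply, hu, hv, Pi.add_apply, Pi.add_apply]; ring

theorem IsGradient.sub {u v : V → ℝ} {h k : EdgeSpace V} (hu : G.IsGradient u h)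
    (hv : G.IsGradient v k) : G.IsGradient (u - v) (h - k) := fun p => by
  rw [lp.coeFn_sub, Pi.sub_apply, hu, hv, Pi.sub_apply, Pi.sub_apply]; ring

theorem IsGradient.smul {u : V → ℝ} {h : EdgeSpace V} (c : ℝ) (hu : G.IsGradient u h) :
    G.IsGradient (c • u) (c • h) := fun p => by
  rw [lp.coeFn_smul, Pi.smul_apply, hu, Pi.smul_apply, Pi.smul_apply]
  simp only [smul_eq_mul]; ring

theorem edgeSpace_norm_sq (h : EdgeSpace V) : HasSum (fun p => h p ^ 2) (‖h‖ ^ 2) := by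
  have := lp.hasSum_norm (p := 2) (by simp) h
  simpa using this

theorem IsGradient.energy_eq {u : V → ℝ} {h : EdgeSpace V} (hu : G.IsGradient u h) :
    G.energy u = ‖h‖ₑ ^ 2 := by
  have hs := edgeSpace_norm_sq h
  rw [energy, ← ENNReal.tsum_mul_left, ← ofReal_norm, ← ENNReal.ofReal_pow (norm_nonneg _),
    ← hs.tsum_eq, ENNReal.ofReal_tsum_of_nonneg (fun p => sq_nonneg _) hs.summable]
  refine tsum_congr fun p => ?_
  rw [hu, sq, sq, mul_gradient_eq, ENNReal.ofReal_mul (by norm_num : (0 : ℝ) ≤ 2⁻¹),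
    ENNReal.ofReal_inv_of_pos two_pos, ENNReal.ofReal_ofNat, mul_assoc]

theorem finiteEnergy_iff {u : V → ℝ} : G.FiniteEnergy u ↔ ∃ h, G.IsGradient u h := by
  constructor
  · intro hu
    rw [FiniteEnergy, energy, ENNReal.mul_lt_top_iff] at hu
    have h1 : ∑' p : V × V, ENNReal.ofReal (G.b p.1 p.2 * (u p.1 - u p.2) ^ 2) ≠ ⊤ := by
      rcases hu with h | h | h
      · exact h.2.ne
      · simp at h
      · rw [h]; simp
    have h2 := ENNReal.summable_toReal h1
    refine ⟨⟨fun p => √(G.b p.1 p.2 / 2) * (u p.1 - u p.2), memℓp_gen ?_⟩, fun p => rfl⟩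
    refine (h2.mul_left 2⁻¹).congr fun p => ?_
    rw [ENNReal.toReal_ofReal (mul_nonneg (G.nonneg _ _) (sq_nonneg _)), ENNReal.toReal_ofNat,
      Real.rpow_two, Real.norm_eq_abs, sq_abs, sq (_ * _), mul_gradient_eq]
    ring
  · rintro ⟨h, hu⟩
    rw [FiniteEnergy, hu.energy_eq]
    exact ENNReal.pow_lt_top enorm_lt_top

theorem IsGradient.form_eq {u v : V → ℝ} {h k : EdgeSpace V} (hu : G.IsGradient u h)
    (hv : G.IsGradient v k) : G.form u v = ⟪h, k⟫_ℝ := by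
  rw [form, lp.inner_eq_tsum, ← tsum_mul_left]
  refine tsum_congr fun p => ?_
  rw [hu, hv, RCLike.inner_apply, conj_trivial, mul_gradient_eq]
  ring

theorem tendsto_edgeSpace_apply {h : ℕ → EdgeSpace V} {k : EdgeSpace V}
    (hk : Tendsto h atTop (𝓝 k)) (p : V × V) : Tendsto (fun n => h n p) atTop (𝓝 (k p)) :=
  tendsto_iff_norm_sub_tendsto_zero.2 <| squeeze_zero (fun _ => norm_nonneg _)
    (fun n => by simpa using lp.norm_apply_le_norm (p := 2) (by simp) (h n - k) p)
    (tendsto_iff_norm_sub_tendsto_zero.1 hk)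

theorem isGradient_of_tendsto {u : ℕ → V → ℝ} {h : ℕ → EdgeSpace V} {v : V → ℝ} {k : EdgeSpace V}
    (hu : ∀ n, G.IsGradient (u n) (h n)) (hv : ∀ x, Tendsto (fun n => u n x) atTop (𝓝 (v x)))
    (hk : Tendsto h atTop (𝓝 k)) : G.IsGradient v k := fun p =>
  tendsto_nhds_unique (tendsto_edgeSpace_apply hk p)
    ((((hv p.1).sub (hv p.2)).const_mul _).congr fun n => (hu n p).symm)

/-- On a connected graph, differences of values are controlled by the energy. -/
theorem Connected.exists_abs_sub_le (hG : G.Connected) (x y : V) :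
    ∃ C : ℝ, 0 ≤ C ∧ ∀ u h, G.IsGradient u h → |u x - u y| ≤ C * ‖h‖ := by
  induction hG x y with
  | refl => exact ⟨0, le_rfl, fun u h _ => by simp⟩
  | @tail z w _ hzw ih =>
    obtain ⟨C, hC, ih⟩ := ih
    have hb : 0 < √(G.b z w / 2) := Real.sqrt_pos.2 (by positivity)
    refine ⟨C + (√(G.b z w / 2))⁻¹, by positivity, fun u h hu => ?_⟩
    have h1 := lp.norm_apply_le_norm (p := 2) (by simp) h (z, w)
    rw [hu, Real.norm_eq_abs, abs_mul, abs_of_pos hb] at h1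
    have h2 : |u z - u w| ≤ (√(G.b z w / 2))⁻¹ * ‖h‖ := by
      rwa [inv_mul_eq_div, le_div_iff₀' hb]
    calc |u x - u w| ≤ |u x - u z| + |u z - u w| := abs_sub_le _ _ _
      _ ≤ (C + (√(G.b z w / 2))⁻¹) * ‖h‖ := by rw [add_mul]; exact add_le_add (ih u h hu) h2

/-! ### Green's formula for finitely supported functions -/

open Classical in
theorem hasSum_ite_fst {g : V → ℝ} {a : ℝ} (hg : HasSum g a) (x : V) :
    HasSum (fun p : V × V => if p.1 = x then g p.2 else 0) a := by
  have hinj : Function.Injective fun y : V => (x, y) := fun y z h => (Prod.mk.inj h).2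
  refine (hinj.hasSum_iff fun p hp => ?_).1 (by simpa [Function.comp_def] using hg)
  rw [if_neg]
  rintro rfl
  exact hp ⟨p.2, rfl⟩

open Classical in
theorem hasSum_ite_snd {g : V → ℝ} {a : ℝ} (hg : HasSum g a) (x : V) :
    HasSum (fun p : V × V => if p.2 = x then g p.1 else 0) a :=
  (Equiv.prodComm V V).hasSum_iff.1 (by simpa [Function.comp_def] using hasSum_ite_fst hg x)

theorem exists_isGradient_single (x : V) :
    ∃ h, G.IsGradient (Finsupp.single x (1 : ℝ)) h := by
  classical
  have h1 := (G.summable x).hasSum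
  have h2 := (hasSum_ite_fst h1 x).add (hasSum_ite_snd h1 x)
  refine ⟨⟨fun p => √(G.b p.1 p.2 / 2) *
    (Finsupp.single x (1 : ℝ) p.1 - Finsupp.single x (1 : ℝ) p.2), memℓp_gen ?_⟩, fun p => rfl⟩
  refine Summable.of_nonneg_of_le (fun p => by positivity) (fun p => ?_) h2.summable
  rw [ENNReal.toReal_ofNat, Real.rpow_two, Real.norm_eq_abs, sq_abs, sq (_ * _), mul_gradient_eq]
  have hb := G.nonneg x p.2
  have hb' := G.nonneg x p.1
  simp only [Finsupp.single_apply, eq_comm (a := x)]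
  by_cases hp1 : p.1 = x
  · by_cases hp2 : p.2 = x
    · simp only [hp1, hp2, if_true]; linarith [G.nonneg x x]
    · simp only [hp1, hp2, if_true, if_false]; linarith
  · by_cases hp2 : p.2 = x
    · simp only [hp1, hp2, if_true, if_false, G.symm p.1 x]; linarith
    · simp [hp1, hp2]

variable (G) in
/-- The gradient of a finitely supported function. -/
noncomputable def grad : (V →₀ ℝ) →ₗ[ℝ] EdgeSpace V :=
  Finsupp.linearCombination ℝ fun x => (G.exists_isGradient_single x).choose

theorem isGradient_grad (φ : V →₀ ℝ) : G.IsGradient φ (G.grad φ) := by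
  induction φ using Finsupp.induction_linear with
  | zero => intro p; simp
  | add φ ψ h1 h2 => rw [map_add, Finsupp.coe_add]; exact h1.add h2
  | single x c =>
    have h := (G.exists_isGradient_single x).choose_spec.smul c
    rw [grad, Finsupp.linearCombination_single]
    have hc : (Finsupp.single x c : V → ℝ) = c • ⇑(Finsupp.single x (1 : ℝ)) := by
      rw [← Finsupp.coe_smul, Finsupp.smul_single, smul_eq_mul, mul_one]
    rwa [hc]

theorem IsGradient.summable {u : V → ℝ} {h : EdgeSpace V} (hu : G.IsGradient u h) (x : V) :
    Summable fun y => G.b x y * (u x - u y) := by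
  have h1 : Summable fun y => h (x, y) ^ 2 :=
    (edgeSpace_norm_sq h).summable.comp_injective (i := fun y : V => (x, y))
      fun y z h => (Prod.mk.inj h).2
  refine Summable.of_norm_bounded ((h1.mul_left 2).add (G.summable x)) fun y => ?_
  rw [hu, sq, mul_gradient_eq, Real.norm_eq_abs, abs_mul, abs_of_nonneg (G.nonneg x y)]
  have h2 := G.nonneg x y
  have h3 : |u x - u y| ≤ (u x - u y) ^ 2 + 1 := by
    rw [← sq_abs]; nlinarith [sq_nonneg (|u x - u y| - 1), abs_nonneg (u x - u y)]
  nlinarith [mul_le_mul_of_nonneg_left h3 h2]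

theorem IsGradient.inner_grad_single {u : V → ℝ} {h : EdgeSpace V} (hu : G.IsGradient u h)
    (x : V) : ⟪h, G.grad (Finsupp.single x 1)⟫_ℝ = ∑' y, G.b x y * (u x - u y) := by
  classical
  have h1 := (hu.summable x).hasSum
  have h2 := ((hasSum_ite_fst h1 x).add (hasSum_ite_snd h1 x)).mul_left 2⁻¹
  rw [lp.inner_eq_tsum]
  refine Eq.trans ?_ (h2.tsum_eq.trans (by ring))
  refine tsum_congr fun p => ?_
  rw [hu, isGradient_grad, RCLike.inner_apply, conj_trivial, mul_comm (_ * _), mul_gradient_eq]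
  simp only [Finsupp.single_apply, eq_comm (a := x)]
  by_cases hp1 : p.1 = x
  · by_cases hp2 : p.2 = x
    · simp [hp1, hp2]
    · simp [hp1, hp2]
  · by_cases hp2 : p.2 = x
    · simp only [hp1, hp2, if_true, if_false, G.symm p.1 x]; ring
    · simp [hp1, hp2]

theorem IsGradient.inner_grad {u : V → ℝ} {h : EdgeSpace V} (hu : G.IsGradient u h)
    (φ : V →₀ ℝ) : ⟪h, G.grad φ⟫_ℝ = φ.sum fun x c => c * ∑' y, G.b x y * (u x - u y) := by
  conv_lhs => rw [← Finsupp.sum_single φ]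
  rw [Finsupp.sum, map_sum, inner_sum, Finsupp.sum]
  refine Finset.sum_congr rfl fun x _ => ?_
  rw [← hu.inner_grad_single x, ← real_inner_smul_right, ← map_smul, Finsupp.smul_single,
    smul_eq_mul, mul_one]

end WeightedGraph

/-! ### The form domain as a closed graph -/

section EllTwo

open scoped InnerProductSpace

variable {V : Type*} [MeasurableSpace V] [DiscreteMeasurableSpace V] {m : V → ℝ}

theorem forall_of_ae_massMeasure (hm : ∀ x, 0 < m x) {p : V → Prop}
    (h : ∀ᵐ x ∂massMeasure m, p x) (x : V) : p x := by
  by_contra hx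
  have h1 : massMeasure m {x} ≤ 0 :=
    (measure_mono (singleton_subset_iff.2 hx)).trans (ae_iff.1 h).le
  rw [massMeasure_singleton, nonpos_iff_eq_zero, ENNReal.ofReal_eq_zero] at h1
  exact absurd (hm x) (not_lt.2 h1)

theorem ellTwo_add_apply (hm : ∀ x, 0 < m x) (f g : EllTwo m) (x : V) :
    (f + g : EllTwo m) x = f x + g x :=
  forall_of_ae_massMeasure hm (Lp.coeFn_add f g) x

theorem ellTwo_sub_apply (hm : ∀ x, 0 < m x) (f g : EllTwo m) (x : V) :
    (f - g : EllTwo m) x = f x - g x :=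
  forall_of_ae_massMeasure hm (Lp.coeFn_sub f g) x

theorem ellTwo_smul_apply (hm : ∀ x, 0 < m x) (c : ℝ) (f : EllTwo m) (x : V) :
    (c • f : EllTwo m) x = c * f x :=
  forall_of_ae_massMeasure hm (Lp.coeFn_smul c f) x

theorem deltaFun_apply (hm : ∀ x, 0 < m x) (x y : V) :
    deltaFun m x y = Finsupp.single x (1 : ℝ) y := by
  classical
  refine (forall_of_ae_massMeasure hm indicatorConstLp_coeFn y).trans ?_
  simp [Finsupp.single_apply, indicator_apply, eq_comm]

theorem inner_deltaFun (hm : ∀ x, 0 < m x) (x : V) (f : EllTwo m) :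
    ⟪deltaFun m x, f⟫_ℝ = m x * f x := by
  rw [deltaFun, L2.inner_indicatorConstLp_one, integral_singleton, measureReal_def,
    massMeasure_singleton, ENNReal.toReal_ofReal (hm x).le, smul_eq_mul]

theorem tendsto_ellTwo_apply (hm : ∀ x, 0 < m x) {ι : Type*} {l : Filter ι} {f : ι → EllTwo m}
    {g : EllTwo m} (h : Tendsto f l (𝓝 g)) (x : V) : Tendsto (fun i => f i x) l (𝓝 (g x)) := by
  have h1 := ((tendsto_const_nhds (x := deltaFun m x)).inner h (𝕜 := ℝ)).const_mul (m x)⁻¹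
  simpa only [inner_deltaFun hm, inv_mul_cancel_left₀ (hm x).ne'] using h1

/-- A finitely supported function as an element of `ℓ²(V, m)`. -/
noncomputable def finsuppToEllTwo (m : V → ℝ) : (V →₀ ℝ) →ₗ[ℝ] EllTwo m :=
  Finsupp.linearCombination ℝ (deltaFun m)

theorem finsuppToEllTwo_single (x : V) : finsuppToEllTwo m (Finsupp.single x 1) = deltaFun m x := by
  rw [finsuppToEllTwo, Finsupp.linearCombination_single, one_smul]

theorem finsuppToEllTwo_apply (hm : ∀ x, 0 < m x) (φ : V →₀ ℝ) (x : V) :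
    finsuppToEllTwo m φ x = φ x := by
  induction φ using Finsupp.induction_linear with
  | zero => rw [map_zero]; exact forall_of_ae_massMeasure hm (Lp.coeFn_zero _ _ _) x
  | add φ ψ h1 h2 => rw [map_add, ellTwo_add_apply hm, h1, h2, Finsupp.add_apply]
  | single y c =>
    rw [finsuppToEllTwo, Finsupp.linearCombination_single, ellTwo_smul_apply hm, deltaFun_apply hm,
      ← smul_eq_mul, ← Finsupp.smul_apply, Finsupp.smul_single, smul_eq_mul, mul_one]

end EllTwo

namespace WeightedGraph

open scoped InnerProductSpace

variable {V : Type*} [MeasurableSpace V] [DiscreteMeasurableSpace V] {G : WeightedGraph V}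
  {m : V → ℝ}

variable (G m) in
/-- The closure in `ℓ²(V, m) × ℓ²(V × V)` of the graph of the gradient on finitely supported
functions. Its projection to the first factor is the domain of `Q^D`. -/
noncomputable def gradGraph : Submodule ℝ (EllTwo m × EdgeSpace V) :=
  (LinearMap.range ((finsuppToEllTwo m).prod G.grad)).topologicalClosure

theorem isClosed_gradGraph : IsClosed (G.gradGraph m : Set (EllTwo m × EdgeSpace V)) :=
  Submodule.isClosed_topologicalClosure _

theorem mem_gradGraph_iff {u : EllTwo m} {h : EdgeSpace V} :
    (u, h) ∈ G.gradGraph m ↔ ∃ φ : ℕ → V →₀ ℝ,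
      Tendsto (fun n => finsuppToEllTwo m (φ n)) atTop (𝓝 u) ∧
      Tendsto (fun n => G.grad (φ n)) atTop (𝓝 h) := by
  rw [gradGraph, ← SetLike.mem_coe, Submodule.topologicalClosure_coe, mem_closure_iff_seq_limit]
  constructor
  · rintro ⟨x, hx, hlim⟩
    choose φ hφ using hx
    obtain rfl : x = fun n => (finsuppToEllTwo m (φ n), G.grad (φ n)) :=
      funext fun n => (hφ n).symm
    exact ⟨φ, (continuous_fst.tendsto _).comp hlim, (continuous_snd.tendsto _).comp hlim⟩
  · rintro ⟨φ, h1, h2⟩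
    exact ⟨fun n => (finsuppToEllTwo m (φ n), G.grad (φ n)), fun n => ⟨φ n, rfl⟩,
      h1.prodMk_nhds h2⟩

theorem finsupp_mem_gradGraph (φ : V →₀ ℝ) : (finsuppToEllTwo m φ, G.grad φ) ∈ G.gradGraph m :=
  mem_gradGraph_iff.2 ⟨fun _ => φ, tendsto_const_nhds, tendsto_const_nhds⟩

theorem isGradient_of_mem_gradGraph (hm : ∀ x, 0 < m x) {u : EllTwo m} {h : EdgeSpace V}
    (huh : (u, h) ∈ G.gradGraph m) : G.IsGradient u h := by
  obtain ⟨φ, h1, h2⟩ := mem_gradGraph_iff.1 huh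
  refine isGradient_of_tendsto (fun n => isGradient_grad (φ n)) (fun x => ?_) h2
  simpa only [finsuppToEllTwo_apply hm] using tendsto_ellTwo_apply hm h1 x

theorem mem_formDomain_iff (hm : ∀ x, 0 < m x) {u : EllTwo m} :
    u ∈ G.formDomain m ↔ ∃ h, (u, h) ∈ G.gradGraph m := by
  have key : ∀ (h : EdgeSpace V) (φ : V →₀ ℝ), G.IsGradient u h →
      G.energy (u - finsuppToEllTwo m φ : EllTwo m) = ‖h - G.grad φ‖ₑ ^ 2 := fun h φ hu => by
    refine IsGradient.energy_eq ?_
    convert hu.sub (isGradient_grad φ) using 1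
    ext x
    rw [ellTwo_sub_apply hm, Pi.sub_apply, finsuppToEllTwo_apply hm]
  constructor
  · rintro ⟨hu, φ, hφ, hlim⟩
    obtain ⟨h, hu⟩ := finiteEnergy_iff.1 hu
    have hψ : ∀ n, ∃ ψ : V →₀ ℝ, φ n = finsuppToEllTwo m ψ := fun n =>
      ⟨Finsupp.ofSupportFinite _ (hφ n), Lp.ext (Eventually.of_forall fun x => by
        rw [finsuppToEllTwo_apply hm, Finsupp.ofSupportFinite_coe])⟩
    choose ψ hψ using hψ
    simp only [hψ, key h _ hu] at hlim
    have hsq : ∀ a : ℕ → ℝ≥0∞, Tendsto (fun n => a n ^ 2) atTop (𝓝 0) →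
        Tendsto a atTop (𝓝 0) := fun a ha => by
      have h1 := ((ENNReal.continuous_rpow_const (y := 1 / 2)).tendsto _).comp ha
      rw [ENNReal.zero_rpow_of_pos (by norm_num)] at h1
      refine h1.congr fun n => ?_
      rw [Function.comp_apply, ← ENNReal.rpow_natCast, ← ENNReal.rpow_mul]
      norm_num
    refine ⟨h, mem_gradGraph_iff.2 ⟨ψ, ?_, ?_⟩⟩
    · rw [tendsto_iff_edist_tendsto_0]
      refine hsq _ (tendsto_of_tendsto_of_tendsto_of_le_of_le tendsto_const_nhds hlim
        (fun _ => zero_le) fun n => ?_)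
      simp only [edist_comm _ u, edist_eq_enorm_sub]
      exact le_add_self
    · rw [tendsto_iff_edist_tendsto_0]
      refine hsq _ (tendsto_of_tendsto_of_tendsto_of_le_of_le tendsto_const_nhds hlim
        (fun _ => zero_le) fun n => ?_)
      simp only [edist_comm _ h, edist_eq_enorm_sub]
      exact le_self_add
  · rintro ⟨h, huh⟩
    have hu := isGradient_of_mem_gradGraph hm huh
    obtain ⟨φ, h1, h2⟩ := mem_gradGraph_iff.1 huh
    refine ⟨finiteEnergy_iff.2 ⟨h, hu⟩, fun n => finsuppToEllTwo m (φ n), fun n => ?_, ?_⟩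
    · refine (φ n).hasFiniteSupport.subset fun x hx => ?_
      rwa [Function.mem_support, finsuppToEllTwo_apply hm] at hx
    · simp only [key h _ hu]
      rw [tendsto_iff_edist_tendsto_0] at h1 h2
      simp only [edist_comm _ u, edist_comm _ h, edist_eq_enorm_sub] at h1 h2
      have h3 := ((ENNReal.continuous_pow 2).tendsto _).comp h1
      have h4 := ((ENNReal.continuous_pow 2).tendsto _).comp h2
      simpa [Function.comp_def] using h4.add h3

theorem isGeneratorValue_iff (hm : ∀ x, 0 < m x) {u w : EllTwo m} :
    G.IsGeneratorValue m u w ↔ (u, w) ∈ formOperator (G.gradGraph m) := by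
  rw [IsGeneratorValue, mem_formOperator, mem_formDomain_iff hm]
  constructor
  · rintro ⟨⟨h, huh⟩, hv⟩
    refine ⟨h, huh, fun q hq => ?_⟩
    rw [← hv q.1 ((mem_formDomain_iff hm).2 ⟨q.2, hq⟩)]
    exact ((isGradient_of_mem_gradGraph hm huh).form_eq (isGradient_of_mem_gradGraph hm hq)).symm
  · rintro ⟨h, huh, hv⟩
    refine ⟨⟨h, huh⟩, fun v hvd => ?_⟩
    obtain ⟨k, hk⟩ := (mem_formDomain_iff hm).1 hvd
    rw [← hv _ hk]
    exact (isGradient_of_mem_gradGraph hm huh).form_eq (isGradient_of_mem_gradGraph hm hk)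

theorem isAssociatedSemigroup_iff (hm : ∀ x, 0 < m x) {T : ℝ → EllTwo m →L[ℝ] EllTwo m} :
    G.IsAssociatedSemigroup m T ↔ IsSemigroupGeneratedBy (formOperator (G.gradGraph m)) T :=
  ⟨fun h => ⟨h.symmetric, h.semigroup, h.contractive, h.strongly_continuous, fun u w =>
    (h.generator u w).trans (isGeneratorValue_iff hm)⟩,
   fun h => ⟨h.symmetric, h.semigroup, h.contractive, h.strongly_continuous, fun u w =>
    (h.generator u w).trans (isGeneratorValue_iff hm).symm⟩⟩

variable (G) in
theorem exists_isAssociatedSemigroup (hm : ∀ x, 0 < m x) :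
    ∃ T : ℝ → EllTwo m →L[ℝ] EllTwo m, G.IsAssociatedSemigroup m T := by
  simp only [isAssociatedSemigroup_iff hm]
  refine (isNonnegSelfAdjoint_formOperator isClosed_gradGraph fun f hf => ?_).exists_semigroup
  refine Lp.ext (Eventually.of_forall fun x => ?_)
  have h1 := hf _ (finsupp_mem_gradGraph (Finsupp.single x 1))
  rw [finsuppToEllTwo_single, real_inner_comm, inner_deltaFun hm] at h1
  rw [forall_of_ae_massMeasure hm (Lp.coeFn_zero _ _ _) x]
  exact (mul_eq_zero.1 h1).resolve_left (hm x).ne'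

end WeightedGraph

/-! ### Vertices of zero capacity -/

namespace WeightedGraph

open scoped InnerProductSpace

section Capacity

variable {V : Type*} {G : WeightedGraph V}

variable (G) in
/-- The vertex `o` has zero capacity: there are finitely supported functions of arbitrarily small
energy whose value at `o` is arbitrarily close to `1`. -/
def ZeroCapacityAt (o : V) : Prop :=
  ((1 : ℝ), (0 : EdgeSpace V)) ∈ closure (range fun φ : V →₀ ℝ => (φ o, G.grad φ))

theorem mem_closure_range_grad_iff {o : V} {a : ℝ} {h : EdgeSpace V} :
    (a, h) ∈ closure (range fun φ : V →₀ ℝ => (φ o, G.grad φ)) ↔ ∃ φ : ℕ → V →₀ ℝ,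
      Tendsto (fun n => φ n o) atTop (𝓝 a) ∧ Tendsto (fun n => G.grad (φ n)) atTop (𝓝 h) := by
  rw [mem_closure_iff_seq_limit]
  constructor
  · rintro ⟨x, hx, hlim⟩
    choose φ hφ using hx
    obtain rfl : x = fun n => (φ n o, G.grad (φ n)) := funext fun n => (hφ n).symm
    exact ⟨φ, (continuous_fst.tendsto _).comp hlim, (continuous_snd.tendsto _).comp hlim⟩
  · rintro ⟨φ, h1, h2⟩
    exact ⟨fun n => (φ n o, G.grad (φ n)), fun n => ⟨φ n, rfl⟩, h1.prodMk_nhds h2⟩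

/-- On a connected graph, if gradients of finitely supported functions converge and their values
converge at one vertex, then the limit is the gradient of a function. -/
theorem Connected.exists_isGradient_of_mem_closure (hG : G.Connected) {o : V} {a : ℝ}
    {h : EdgeSpace V} (hah : (a, h) ∈ closure (range fun φ : V →₀ ℝ => (φ o, G.grad φ))) :
    ∃ u, G.IsGradient u h := by
  obtain ⟨φ, h1, h2⟩ := mem_closure_range_grad_iff.1 hah
  have hc : ∀ x, ∃ y, Tendsto (fun n => φ n x) atTop (𝓝 y) := by
    intro x
    obtain ⟨C, hC, hx⟩ := hG.exists_abs_sub_le x o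
    have h3 : CauchySeq fun n => φ n x - φ n o := by
      refine Metric.cauchySeq_iff'.2 fun ε hε => ?_
      obtain ⟨N, hN⟩ := Metric.cauchySeq_iff'.1 h2.cauchySeq (ε / (C + 1)) (by positivity)
      refine ⟨N, fun n hn => ?_⟩
      have h4 := hx _ _ ((isGradient_grad (φ n)).sub (isGradient_grad (φ N)))
      have h5 := hN n hn
      rw [dist_eq_norm, lt_div_iff₀ (by positivity)] at h5
      have h6 := norm_nonneg (G.grad (φ n) - G.grad (φ N))
      rw [Real.dist_eq, sub_sub_sub_comm]
      exact h4.trans_lt (by nlinarith)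
    obtain ⟨y, hy⟩ := cauchySeq_tendsto_of_complete h3
    exact ⟨y + a, by simpa using hy.add h1⟩
  choose u hu using hc
  exact ⟨u, isGradient_of_tendsto (fun n => isGradient_grad (φ n)) hu h2⟩

/-- If the capacity of `o` is positive, then there is a function of finite energy, a multiple of
the Green's function, whose Laplacian is a nonzero multiple of the unit mass at `o`. -/
theorem Connected.exists_green_of_not_zeroCapacityAt (hG : G.Connected) {o : V}
    (ho : ¬ G.ZeroCapacityAt o) : ∃ (c : ℝ) (u : V → ℝ) (h : EdgeSpace V), c ≠ 0 ∧
      G.IsGradient u h ∧ ∀ φ : V →₀ ℝ, ⟪h, G.grad φ⟫_ℝ = c * φ o := by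
  obtain ⟨c, h, hc, ⟨a, hah⟩, hφ⟩ :=
    (mem_closure_or_exists_representation (Finsupp.lapply o) G.grad).resolve_left ho
  obtain ⟨u, hu⟩ := hG.exists_isGradient_of_mem_closure hah
  exact ⟨c, u, h, hc, hu, hφ⟩

/-- Truncation to `[0, 1]` does not increase the energy. -/
theorem norm_grad_mapRange_clip_le (φ : V →₀ ℝ) :
    ‖G.grad (φ.mapRange (fun r => max 0 (min 1 r)) (by simp))‖ ≤ ‖G.grad φ‖ := by
  rw [← sq_le_sq₀ (norm_nonneg _) (norm_nonneg _)]
  refine hasSum_le (fun p => ?_) (edgeSpace_norm_sq _) (edgeSpace_norm_sq _)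
  rw [isGradient_grad, isGradient_grad, mul_pow, mul_pow]
  refine mul_le_mul_of_nonneg_left ?_ (sq_nonneg _)
  rw [sq_le_sq, Finsupp.mapRange_apply, Finsupp.mapRange_apply]
  refine (abs_max_sub_max_le_max _ _ _ _).trans ?_
  rw [sub_self, abs_zero, max_eq_right (abs_nonneg _)]
  refine (abs_min_sub_min_le_max _ _ _ _).trans ?_
  rw [sub_self, abs_zero, max_eq_right (abs_nonneg _)]

theorem formalLaplacian_mul_eq {m : V → ℝ} (hm : ∀ x, 0 < m x) (u : V → ℝ) (x : V) :
    G.formalLaplacian m u x * m x = ∑' y, G.b x y * (u x - u y) := by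
  rw [formalLaplacian, mul_comm, mul_inv_cancel_left₀ (hm x).ne']

/-- If some vertex has zero capacity, then finitely supported functions with values in `[0, 1]` and
energy tending to zero converge to `1` everywhere, and Green's formula against them shows that the
Laplacian of every function of finite energy has total mass zero. -/
theorem Connected.tsum_formalLaplacian_eq_zero (hG : G.Connected) {m : V → ℝ} (hm : ∀ x, 0 < m x)
    {o : V} (ho : G.ZeroCapacityAt o) {u : V → ℝ} (hu : G.FiniteEnergy u)
    (hs : Summable fun x => |G.formalLaplacian m u x| * m x) :
    ∑' x, G.formalLaplacian m u x * m x = 0 := by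
  obtain ⟨h, hu⟩ := finiteEnergy_iff.1 hu
  obtain ⟨φ, h1, h2⟩ := mem_closure_range_grad_iff.1 ho
  set ψ : ℕ → V →₀ ℝ := fun n => (φ n).mapRange (fun r => max 0 (min 1 r)) (by simp)
  have hgrad : Tendsto (fun n => G.grad (ψ n)) atTop (𝓝 0) :=
    squeeze_zero_norm (fun n => norm_grad_mapRange_clip_le (φ n)) (by simpa using h2.norm)
  have hφ : ∀ x, Tendsto (fun n => φ n x) atTop (𝓝 1) := fun x => by
    obtain ⟨C, hC, hx⟩ := hG.exists_abs_sub_le x o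
    have h3 : Tendsto (fun n => φ n x - φ n o) atTop (𝓝 0) :=
      squeeze_zero_norm (fun n => hx _ _ (isGradient_grad (φ n)))
        (by simpa using h2.norm.const_mul C)
    simpa using h3.add h1
  have hψ : ∀ x, Tendsto (fun n => ψ n x) atTop (𝓝 1) := fun x => by
    simpa [ψ] using (tendsto_const_nhds (x := (0 : ℝ))).max
      ((tendsto_const_nhds (x := (1 : ℝ))).min (hφ x))
  have hsum : ∀ n, ∑' x, ψ n x * (G.formalLaplacian m u x * m x) = ⟪h, G.grad (ψ n)⟫_ℝ := by
    intro n
    rw [hu.inner_grad, Finsupp.sum, tsum_eq_sum (s := (ψ n).support)]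
    · exact Finset.sum_congr rfl fun x _ => by rw [formalLaplacian_mul_eq hm]
    · intro x hx
      rw [Finsupp.notMem_support_iff.1 hx, zero_mul]
  have h4 : Tendsto (fun n => ∑' x, ψ n x * (G.formalLaplacian m u x * m x)) atTop
      (𝓝 (∑' x, 1 * (G.formalLaplacian m u x * m x))) := by
    refine tendsto_tsum_of_dominated_convergence hs (fun x => (hψ x).mul_const _)
      (Eventually.of_forall fun n x => ?_)
    rw [Real.norm_eq_abs, abs_mul, abs_mul, abs_of_pos (hm x)]
    refine mul_le_of_le_one_left (mul_nonneg (abs_nonneg _) (hm x).le) ?_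
    rw [Finsupp.mapRange_apply, abs_of_nonneg (le_max_left _ _)]
    exact max_le zero_le_one (min_le_left _ _)
  simp only [one_mul, hsum] at h4
  refine tendsto_nhds_unique h4 ?_
  simpa using (tendsto_const_nhds (x := h)).inner hgrad (𝕜 := ℝ)

/-- If the Laplacian of every function of finite energy has total mass zero, then every vertex has
zero capacity: otherwise the Green's function is a counterexample. -/
theorem Connected.zeroCapacityAt_of_tsum_formalLaplacian_eq_zero (hG : G.Connected) {m : V → ℝ}
    (hm : ∀ x, 0 < m x) (H : ∀ u : V → ℝ, G.FiniteEnergy u →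
      Summable (fun x => |G.formalLaplacian m u x| * m x) →
        ∑' x, G.formalLaplacian m u x * m x = 0) (o : V) : G.ZeroCapacityAt o := by
  classical
  by_contra ho
  obtain ⟨c, u, h, hc, hu, hφ⟩ := hG.exists_green_of_not_zeroCapacityAt ho
  have h1 : ∀ x, G.formalLaplacian m u x * m x = if x = o then c else 0 := fun x => by
    rw [formalLaplacian_mul_eq hm, ← hu.inner_grad_single, hφ, Finsupp.single_apply, mul_ite,
      mul_one, mul_zero]
  have h2 := H u (finiteEnergy_iff.2 ⟨h, hu⟩) (by
    have h3 : (fun x => |G.formalLaplacian m u x| * m x) = fun x => if x = o then |c| else 0 :=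
      funext fun x => by
        rw [show |G.formalLaplacian m u x| * m x = |G.formalLaplacian m u x * m x| by
          rw [abs_mul, abs_of_pos (hm x)], h1]
        split_ifs <;> simp
    rw [h3]
    exact (hasSum_ite_eq o |c|).summable)
  rw [tsum_congr h1, tsum_ite_eq] at h2
  exact hc h2

end Capacity

/-! ### Recurrence and capacity -/

section Recurrence

variable {V : Type*} [MeasurableSpace V] [DiscreteMeasurableSpace V] {G : WeightedGraph V}
  {m : V → ℝ} {T : ℝ → EllTwo m →L[ℝ] EllTwo m}

theorem integral_apply_eq (hm : ∀ x, 0 < m x)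
    (hT : IsSemigroupGeneratedBy (formOperator (G.gradGraph m)) T) (f : EllTwo m) (y : V) {N : ℝ}
    (hN : 0 ≤ N) : (∫ t in 0..N, T t f : EllTwo m) y = ∫ t in 0..N, T t f y := by
  have h1 := hT.inner_integral f (deltaFun m y) hN
  simp only [inner_deltaFun hm] at h1
  rw [intervalIntegral.integral_const_mul] at h1
  exact mul_left_cancel₀ (hm y).ne' h1

theorem intervalIntegrable_apply (hm : ∀ x, 0 < m x)
    (hT : IsSemigroupGeneratedBy (formOperator (G.gradGraph m)) T) (f : EllTwo m) (y : V) {N : ℝ}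
    (hN : 0 ≤ N) : IntervalIntegrable (fun t => T t f y) volume 0 N := by
  have h1 := (hT.intervalIntegrable_inner f (deltaFun m y) hN).const_mul (m y)⁻¹
  simpa only [inner_deltaFun hm, inv_mul_cancel_left₀ (hm y).ne'] using h1

/-- The time integral `v = ∫₀ᴺ T t δ_x dt` lies in the form domain, satisfies
`Q(v, φ) = ⟪δ_x - T N δ_x, φ⟫`, and has energy at most `m x * v x`. -/
theorem exists_isGradient_integral (hm : ∀ x, 0 < m x)
    (hT : IsSemigroupGeneratedBy (formOperator (G.gradGraph m)) T) (x : V) {N : ℝ} (hN : 0 < N) :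
    ∃ k, ((∫ t in 0..N, T t (deltaFun m x) : EllTwo m), k) ∈ G.gradGraph m ∧
      ‖k‖ ^ 2 ≤ m x * (∫ t in 0..N, T t (deltaFun m x) : EllTwo m) x ∧
      ∀ φ : V →₀ ℝ, ⟪k, G.grad φ⟫_ℝ =
        ⟪deltaFun m x - T N (deltaFun m x), finsuppToEllTwo m φ⟫_ℝ := by
  obtain ⟨k, hk, hk'⟩ := mem_formOperator.1 (hT.integral_mem (deltaFun m x) hN)
  refine ⟨k, hk, ?_, fun φ => hk' _ (finsupp_mem_gradGraph φ)⟩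
  rw [← real_inner_self_eq_norm_sq, hk' _ hk, ← inner_deltaFun hm]
  exact hT.inner_sub_integral_le _ hN

/-- If the capacity of `o` is positive, then `|u o|` is controlled by the energy on the form domain,
so that the energies of `∫₀ᴺ T t δ_o dt` stay bounded and the time integral at `(o, o)` is finite. -/
theorem zeroCapacityAt_of_lintegral_eq_top (hG : G.Connected) (hm : ∀ x, 0 < m x)
    (hT : IsSemigroupGeneratedBy (formOperator (G.gradGraph m)) T) {o : V}
    (ho : ∫⁻ t in Ioi (0 : ℝ), ENNReal.ofReal (T t (deltaFun m o) o) = ⊤) :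
    G.ZeroCapacityAt o := by
  by_contra hcap
  obtain ⟨c, _, h, hc, _, hφ⟩ := hG.exists_green_of_not_zeroCapacityAt hcap
  have hbound : ∀ (u : EllTwo m) (k : EdgeSpace V), (u, k) ∈ G.gradGraph m →
      |u o| ≤ ‖h‖ / |c| * ‖k‖ := by
    intro u k huk
    obtain ⟨φ, h1, h2⟩ := mem_gradGraph_iff.1 huk
    have h3 := tendsto_ellTwo_apply hm h1 o
    simp only [finsuppToEllTwo_apply hm] at h3
    refine le_of_tendsto_of_tendsto' h3.abs (h2.norm.const_mul _) fun n => ?_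
    rw [div_mul_eq_mul_div, le_div_iff₀ (abs_pos.2 hc), mul_comm, ← abs_mul, ← hφ]
    exact abs_real_inner_le_norm _ _
  have hB : ∀ N, 0 < N → ∫ t in 0..N, T t (deltaFun m o) o ≤ (‖h‖ / |c|) ^ 2 * m o := by
    intro N hN
    obtain ⟨k, hk, hk2, -⟩ := exists_isGradient_integral hm hT o hN
    rw [← integral_apply_eq hm hT _ _ hN.le]
    set v := (∫ t in 0..N, T t (deltaFun m o) : EllTwo m) o
    have h1 := (le_abs_self v).trans (hbound _ _ hk)
    have hb : 0 ≤ ‖h‖ / |c| := by positivity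
    have h2 : ‖k‖ ≤ m o * (‖h‖ / |c|) := by
      rcases (norm_nonneg k).eq_or_lt with h0 | h0
      · rw [← h0]; exact mul_nonneg (hm o).le hb
      · refine le_of_mul_le_mul_right ?_ h0
        nlinarith [mul_le_mul_of_nonneg_left h1 (hm o).le]
    nlinarith [mul_le_mul_of_nonneg_left h2 hb]
  have hnn : ∀ t, 0 < t → 0 ≤ T t (deltaFun m o) o := fun t ht => by
    have := hT.inner_orbit_nonneg (deltaFun m o) ht
    rw [inner_deltaFun hm] at this
    exact nonneg_of_mul_nonneg_right this (hm o)
  have hint : IntegrableOn (fun t => T t (deltaFun m o) o) (Ioi 0) := by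
    refine integrableOn_Ioi_of_intervalIntegral_norm_bounded ((‖h‖ / |c|) ^ 2 * m o) 0
      (l := atTop) (b := fun N : ℝ => max N 0) (fun N => ?_) ?_ ?_
    · exact (intervalIntegrable_iff_integrableOn_Ioc_of_le (le_max_right _ _)).1
        (intervalIntegrable_apply hm hT _ _ (le_max_right _ _))
    · exact tendsto_atTop_mono (fun N => le_max_left N 0) tendsto_id
    · filter_upwards [eventually_gt_atTop 0] with N hN
      rw [max_eq_left hN.le]
      refine le_of_eq_of_le (intervalIntegral.integral_congr_ae
        (Eventually.of_forall fun t ht => ?_)) (hB N hN)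
      rw [uIoc_of_le hN.le] at ht
      exact Real.norm_of_nonneg (hnn t ht.1)
  exact hint.lintegral_lt_top.ne ho

/-- If the time integral at `(x, y)` were finite, then the values at `y` of `v = ∫₀ᴺ T t δ_x dt`
would be bounded in `N`. Since the oscillation `|v x - v y|` is at most a multiple of
`(m x * v x)^(1/2)`, the values at `x` and the energies would be bounded, too, and
`Q(v, φ) → m x * φ x` would contradict the zero capacity of `x`. -/
theorem lintegral_eq_top_of_zeroCapacityAt (hG : G.Connected) (hm : ∀ x, 0 < m x)
    (hT : IsSemigroupGeneratedBy (formOperator (G.gradGraph m)) T) {x : V}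
    (hx : G.ZeroCapacityAt x) (y : V) :
    ∫⁻ t in Ioi (0 : ℝ), ENNReal.ofReal (T t (deltaFun m x) y) = ⊤ := by
  by_contra hfin
  set K := (∫⁻ t in Ioi (0 : ℝ), ENNReal.ofReal (T t (deltaFun m x) y)).toReal
  have hy : ∀ N, 0 < N → (∫ t in 0..N, T t (deltaFun m x) : EllTwo m) y ≤ K := by
    intro N hN
    rw [integral_apply_eq hm hT _ _ hN.le, intervalIntegral.integral_of_le hN.le]
    have h1 := (intervalIntegrable_apply hm hT (deltaFun m x) y hN.le).1
    rw [integral_eq_lintegral_pos_part_sub_lintegral_neg_part h1]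
    refine (sub_le_self _ ENNReal.toReal_nonneg).trans (ENNReal.toReal_mono hfin ?_)
    exact lintegral_mono_set Ioc_subset_Ioi_self
  obtain ⟨C, hC, hosc⟩ := hG.exists_abs_sub_le x y
  -- `v x - K ≤ C √(m x * v x) ≤ (C² m x + v x) / 2`, whence the bound
  have hxb : ∀ N, 0 < N →
      (∫ t in 0..N, T t (deltaFun m x) : EllTwo m) x ≤ 2 * K + C ^ 2 * m x := by
    intro N hN
    obtain ⟨k, hk, hk2, -⟩ := exists_isGradient_integral hm hT x hN
    have h1 := hosc _ _ (isGradient_of_mem_gradGraph hm hk)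
    have h2 := hy N hN
    set v := (∫ t in 0..N, T t (deltaFun m x) : EllTwo m)
    have h3 := le_abs_self (v x - v y)
    have h4 : 2 * (C * ‖k‖) * m x ≤ (C ^ 2 * m x + v x) * m x := by
      nlinarith [sq_nonneg (C * m x - ‖k‖)]
    have h5 := le_of_mul_le_mul_right h4 (hm x)
    linarith
  set B := m x * (2 * K + C ^ 2 * m x)
  have hlim : Tendsto (fun N => T N (deltaFun m x)) atTop (𝓝 0) := by
    refine hT.tendsto_orbit_zero (deltaFun m x) (K := B) fun N hN => ?_
    rw [inner_deltaFun hm]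
    exact mul_le_mul_of_nonneg_left (hxb N hN) (hm x).le
  have hφ : ∀ φ : V →₀ ℝ, m x * φ x ≤ √B * ‖G.grad φ‖ := by
    intro φ
    have h1 : Tendsto (fun N => ⟪deltaFun m x - T N (deltaFun m x), finsuppToEllTwo m φ⟫_ℝ) atTop
        (𝓝 ⟪deltaFun m x - 0, finsuppToEllTwo m φ⟫_ℝ) :=
      (hlim.const_sub _).inner tendsto_const_nhds
    rw [sub_zero, inner_deltaFun hm, finsuppToEllTwo_apply hm] at h1
    refine le_of_tendsto h1 ?_
    filter_upwards [eventually_gt_atTop 0] with N hN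
    obtain ⟨k, hk, hk2, hk3⟩ := exists_isGradient_integral hm hT x hN
    rw [← hk3]
    refine (real_inner_le_norm _ _).trans (mul_le_mul_of_nonneg_right ?_ (norm_nonneg _))
    exact Real.le_sqrt_of_sq_le (hk2.trans (mul_le_mul_of_nonneg_left (hxb N hN) (hm x).le))
  obtain ⟨φ, h1, h2⟩ := mem_closure_range_grad_iff.1 hx
  have h3 := le_of_tendsto_of_tendsto' (h1.const_mul (m x)) (h2.norm.const_mul √B)
    fun n => hφ (φ n)
  rw [mul_one, norm_zero, mul_zero] at h3
  exact (hm x).not_ge h3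

end Recurrence

end WeightedGraph

theorem mainTheorem7 {V : Type*} [Countable V] [Infinite V]
    [MeasurableSpace V] [DiscreteMeasurableSpace V]
    (G : WeightedGraph V) (hG : G.Connected) (m : V → ℝ) (hm : ∀ x, 0 < m x) :
    G.IsRecurrent m ↔
      ∀ u : V → ℝ, G.FiniteEnergy u →
        Summable (fun x => |G.formalLaplacian m u x| * m x) →
        ∑' x, G.formalLaplacian m u x * m x = 0 := by
  constructor
  · rintro ⟨T, hT, hrec⟩ u hu hs
    obtain ⟨o⟩ : Nonempty V := inferInstance
    exact hG.tsum_formalLaplacian_eq_zero hm (WeightedGraph.zeroCapacityAt_of_lintegral_eq_top hG hm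
      ((WeightedGraph.isAssociatedSemigroup_iff hm).1 hT) (hrec o o)) hu hs
  · intro H
    obtain ⟨T, hT⟩ := G.exists_isAssociatedSemigroup hm
    exact ⟨T, hT, fun x => WeightedGraph.lintegral_eq_top_of_zeroCapacityAt hG hm
      ((WeightedGraph.isAssociatedSemigroup_iff hm).1 hT)
      (hG.zeroCapacityAt_of_tsum_formalLaplacian_eq_zero hm H x)⟩
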